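/- Let $d\ge 2$ and $0<l<d$ be integers and let $I$ be a countable (finite or infinite) set with at least two elements. Let $\Omega\subset\mathbb R^d$ be open, bounded and connected, let $X\subset\Omega$ be compact with $\operatorname{int}(X)\neq\emptyset$, and let $\varphi_i:\Omega\to\Omega$ $(i\in I)$ be injective maps with $\varphi_i(X)\subset X$ for which there are numbers $0<s_i<1$ with $|\varphi_i(x)-\varphi_i(y)|\le s_i|x-y|$ for all $x,y\in\Omega$, and which are conformal, i.e. $|\varphi_i'|^d=|J\varphi_i|$ holds $\mathcal H^d$-almost everywhere on $\Omega$ (operator norm on the left, Jacobian determinant on the right). For a nonempty finite word $\mathtt i=(i_1,\dots,i_k)$ over $I$ write $\varphi_{\mathtt i}=\varphi_{i_1}\circ\cdots\circ\varphi_{i_k}$, and let $I^*$ be the set of these words. Assume that $\{\varphi_i\}_{i\in I}$ is a conformal iterated function system (CIFS), that is: 1. $\sup_{i\in I}s_i<1$; 2. there is $K\ge1$ such that $|\varphi_{\mathtt i}'(x)|\le K|\varphi_{\mathtt i}'(y)|$ for all $\mathtt i\in I^*$ and $x,y\in\Omega$; 3. $\varphi_i(\operatorname{int}X)\cap\varphi_j(\operatorname{int}X)=\emptyset$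 for $i\ne j$; 4. there is $r_0>0$ with $\displaystyle\inf_{x\in\partial X}\ \inf_{0<r<r_0}\frac{\mathcal H^d(B(x,r)\cap\operatorname{int}X)}{\mathcal H^d(B(x,r))}>0$. Let $E=\bigcup_{\omega\in I^{\mathbb N}}\bigcap_{n=1}^\infty\varphi_{\omega|_n}(X)$, where $\omega|_n=(\omega_1,\dots,\omega_n)$, be the limit set and put $t=\dim_H(E)$. A $t$-conformal measure is a Borel probability measure $m$ on $E$ such that $m(\varphi_{\mathtt i}(A))=\int_A|\varphi_{\mathtt i}'|^t\,dm$ for every $\mathtt i\in I^*$ and every Borel set $A\subset X$; the CIFS is regular if such a measure exists. An $l$-dimensional linear subspace $V$ of $\mathbb R^d$ is a $(t,l)$-tangent plane for $E$ at $a$ (with respect to $m$) if, for every $0<\delta<1$, $$\lim_{r\searrow0}\frac{m\bigl(B(a,r)\setminus X(a,V,\delta)\bigr)}{r^t}=0,\qquad X(a,V,\delta)=\{x\in\mathbb R^d:|Q_V(x-a)|<\sqrt\delta\,|x-a|\},$$ where $Q_V$ is the orthogonal projection onto $V^\perp$. Then either $\mathcal H^t(E\cap M)=0$ for every $l$-dimensional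 $C^1$-submanifold $M\subset\mathbb R^d$, or the CIFS is regular and, for every $t$-conformal measure $m$, at least one point of $E$ has a $(t,l)$-tangent plane with respect to $m$. -/

import Mathlib

open MeasureTheory Set Filter Topology
open scoped ENNReal NNReal

/-- The composition `φ_{i₁} ∘ ⋯ ∘ φ_{iₖ}` along a finite word `[i₁, …, iₖ]`. -/
def wordMap {I α : Type*} (φ : I → α → α) : List I → α → α
  | [] => id
  | i :: w => φ i ∘ wordMap φ w

/-- A conformal iterated function system on `ℝ^d` indexed by `I`. Only the values of the maps `φ i`
on the open set `Ω` matter. -/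
structure CIFS (d : ℕ) (I : Type*) where
  /-- the domain of the maps -/
  Ω : Set (EuclideanSpace ℝ (Fin d))
  /-- the compact set mapped into itself -/
  X : Set (EuclideanSpace ℝ (Fin d))
  /-- the generating maps -/
  φ : I → EuclideanSpace ℝ (Fin d) → EuclideanSpace ℝ (Fin d)
  isOpen_Ω : IsOpen Ω
  isBounded_Ω : Bornology.IsBounded Ω
  isConnected_Ω : IsConnected Ω
  isCompact_X : IsCompact X
  X_subset_Ω : X ⊆ Ω
  nonempty_interior_X : (interior X).Nonempty
  mapsTo_Ω : ∀ i, MapsTo (φ i) Ω Ω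
  injOn_Ω : ∀ i, InjOn (φ i) Ω
  mapsTo_X : ∀ i, MapsTo (φ i) X X
  /-- conformality: `|φ_i'|^d = |J φ_i|` almost everywhere in `Ω` (the derivative of the Lipschitz
  map `φ_i` exists almost everywhere) -/
  conformal : ∀ i, ∀ᵐ x ∂((μH[(d : ℝ)] : Measure (EuclideanSpace ℝ (Fin d))).restrict Ω),
    ‖fderiv ℝ (φ i) x‖ ^ d = |(fderiv ℝ (φ i) x).det|
  /-- each map is contractive, and the system is uniformly contractive -/
  uniformly_contractive : ∃ s : I → ℝ, (∀ i, 0 < s i ∧ s i < 1) ∧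
    (∀ i, ∀ x ∈ Ω, ∀ y ∈ Ω, ‖φ i x - φ i y‖ ≤ s i * ‖x - y‖) ∧ (⨆ i, s i) < 1
  /-- bounded distortion property -/
  bounded_distortion : ∃ K : ℝ, 1 ≤ K ∧ ∀ w : List I, w ≠ [] → ∀ x ∈ Ω, ∀ y ∈ Ω,
    ‖fderiv ℝ (wordMap φ w) x‖ ≤ K * ‖fderiv ℝ (wordMap φ w) y‖
  /-- open set condition -/
  open_set_condition : ∀ i j, i ≠ j → (φ i '' interior X) ∩ (φ j '' interior X) = ∅
  /-- the interior of `X` has uniformly positive lower density at the boundary of `X` -/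
  boundary_density : ∃ r₀ : ℝ, 0 < r₀ ∧
    0 < ⨅ x ∈ frontier X, ⨅ r ∈ Ioo (0 : ℝ) r₀,
      (μH[(d : ℝ)] (Metric.closedBall x r ∩ interior X) / μH[(d : ℝ)] (Metric.closedBall x r))

namespace CIFS

variable {d : ℕ} {I : Type*}

/-- The limit set `E = ⋃_{ω ∈ I^ℕ} ⋂_{n ≥ 1} φ_{ω|n}(X)`. -/
def limitSet (S : CIFS d I) : Set (EuclideanSpace ℝ (Fin d)) :=
  ⋃ ω : ℕ → I, ⋂ n : ℕ, wordMap S.φ ((List.range (n + 1)).map ω) '' S.X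

/-- `m` is a `t`-conformal measure of the system: a Borel probability measure carried by the limit
set with `m(φ_w(A)) = ∫_A |φ_w'|^t dm` for all nonempty finite words `w` and Borel sets `A ⊆ X`. -/
structure IsConformalMeasure (S : CIFS d I) (t : ℝ)
    (m : Measure (EuclideanSpace ℝ (Fin d))) : Prop where
  isProbabilityMeasure : IsProbabilityMeasure m
  compl_limitSet : m (S.limitSet)ᶜ = 0
  conformal : ∀ w : List I, w ≠ [] → ∀ A : Set (EuclideanSpace ℝ (Fin d)),
    A ⊆ S.X → MeasurableSet A →
      m (wordMap S.φ w '' A) = ∫⁻ x in A, ENNReal.ofReal (‖fderiv ℝ (wordMap S.φ w) x‖ ^ t) ∂m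

/-- The system is regular (for the exponent `t`, which is the dimension of the limit set). -/
def IsRegular (S : CIFS d I) (t : ℝ) : Prop :=
  ∃ m : Measure (EuclideanSpace ℝ (Fin d)), S.IsConformalMeasure t m

end CIFS

/-- The cone `X(a, V, δ) = {x : |Q_V (x - a)| < √δ |x - a|}`, where `Q_V` is the orthogonal
projection onto the orthogonal complement of `V`. -/
def coneAround {d : ℕ} (a : EuclideanSpace ℝ (Fin d))
    (V : Submodule ℝ (EuclideanSpace ℝ (Fin d))) (δ : ℝ) : Set (EuclideanSpace ℝ (Fin d)) :=
  {x | ‖Vᗮ.starProjection (x - a)‖ < √δ * ‖x - a‖}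

/-- `V` is a `(t, l)`-tangent plane at `a` with respect to the measure `m`. -/
def IsTangentPlane {d : ℕ} (m : Measure (EuclideanSpace ℝ (Fin d))) (t : ℝ) (l : ℕ)
    (a : EuclideanSpace ℝ (Fin d)) (V : Submodule ℝ (EuclideanSpace ℝ (Fin d))) : Prop :=
  Module.finrank ℝ V = l ∧ ∀ δ : ℝ, 0 < δ → δ < 1 →
    Tendsto (fun r : ℝ => m (Metric.closedBall a r \ coneAround a V δ) / ENNReal.ofReal (r ^ t))
      (𝓝[>] 0) (𝓝 0)

/-- `M` is an `l`-dimensional (embedded) `C¹`-submanifold of `ℝ^d`: near each of its points some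
`C¹`-diffeomorphism between open sets straightens `M` to the coordinate subspace `ℝ^l × {0}`. -/
def IsC1Submanifold {d : ℕ} (l : ℕ) (M : Set (EuclideanSpace ℝ (Fin d))) : Prop :=
  ∀ p ∈ M, ∃ e : OpenPartialHomeomorph (EuclideanSpace ℝ (Fin d)) (EuclideanSpace ℝ (Fin d)),
    p ∈ e.source ∧ ContDiffOn ℝ 1 e e.source ∧ ContDiffOn ℝ 1 e.symm e.target ∧
      ∀ x ∈ e.source, x ∈ M ↔ ∀ j : Fin d, l ≤ (j : ℕ) → e x j = 0

/-! Suppose `ℋ^t(E ∩ M) > 0` for some submanifold `M`. The plan is to show `0 < ℋ^t(E) < ∞`, to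
compare every conformal measure with `ℋ^t` on `E`, and to read off a tangent plane at a density
point of `E ∩ M`.

Regularity of the maps. The convention that `fderiv` is zero at points of non-differentiability,
together with bounded distortion, makes the derivative of each `φ_w` either zero throughout `Ω` or
nonzero throughout. The first case would make the injective Lipschitz map constant (`ratio_pos`), so
every `φ_w` is differentiable everywhere in `Ω`. Conformality is assumed only almost everywhere and
the derivative is not known to be continuous; a volume-averaging argument
(`opNorm_fderiv_pow_eq_abs_det_of_ae`) extends it to all points. Hence all derivatives are
similarities, norms of derivatives multiply along words, and `ℋ^t` obeys a change of variables
formula (`hausdorffMeasure_image_eq_lintegral`).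

Finiteness. A Bernoulli measure on sequences of words and the mass distribution principle give
`ℋ^s(E) > 0` as soon as a finite level sum of `(ρ_w / K)^s` reaches one. Therefore these sums are at
most one for `s = t = dim E` (`sum_ratio_rpow_le`), and covering `E` by cylinders gives `ℋ^t(E) <
∞`.

Overlaps. The boundary density condition bounds the number of pairwise incomparable cylinders
through a point. The set of points of `E` of the largest multiplicity that is still non-null is
invariant and has full measure, which forces overlaps of cylinders to be null
(`hausdorffMeasure_overlap_eq_zero`). So normalised `ℋ^t` on `E` is conformal, and the system is
regular. Comparison on cylinders bounds any conformal measure `m` by a multiple of `ℋ^t` on `E`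
(`exists_le_hausdorffMeasure`).

Tangent plane. At almost every `a ∈ E ∩ M` the set `E \ M` has zero upper `t`-density, while near
`a` the points of `M` other than `a` lie in any prescribed cone around the tangent space of `M`.
Thus the part of `m` outside the cone is `o(r^t)`. -/

section SingleMap

open Module Metric

/-! ### Linear maps: determinant against operator norm -/

section Linear

variable {E : Type*} [NormedAddCommGroup E] [NormedSpace ℝ E] [FiniteDimensional ℝ E]
  [MeasurableSpace E] [BorelSpace E]

theorem abs_det_le_opNorm_pow (μ : Measure E) [μ.IsAddHaarMeasure] (A : E →L[ℝ] E) :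
    |A.det| ≤ ‖A‖ ^ finrank ℝ E := by
  have h1 : A '' closedBall 0 1 ⊆ closedBall 0 ‖A‖ := by
    rintro _ ⟨x, hx, rfl⟩
    rw [mem_closedBall_zero_iff] at hx ⊢
    exact (A.le_opNorm x).trans (mul_le_of_le_one_right (norm_nonneg _) hx)
  have h2 := measure_mono (μ := μ) h1
  rw [Measure.addHaar_image_continuousLinearMap,
    Measure.addHaar_closedBall' μ 0 (norm_nonneg A)] at h2
  have h3 := (ENNReal.mul_le_mul_iff_left
    (measure_closedBall_pos μ (0 : E) one_pos).ne' measure_closedBall_lt_top.ne).1 h2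
  exact (ENNReal.ofReal_le_ofReal_iff (by positivity)).1 h3

/-- A linear map whose Jacobian is the `d`-th power of its norm is a similarity. -/
theorem norm_apply_eq_of_opNorm_pow_eq_abs_det (μ : Measure E) [μ.IsAddHaarMeasure]
    (A : E →L[ℝ] E)
    (hA : ‖A‖ ^ finrank ℝ E = |A.det|) (v : E) : ‖A v‖ = ‖A‖ * ‖v‖ := by
  rcases eq_or_ne A 0 with rfl | hA0
  · simp
  have hc : 0 < ‖A‖ := norm_pos_iff.2 hA0
  have h1 : A '' closedBall 0 1 ⊆ closedBall 0 ‖A‖ := by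
    rintro _ ⟨x, hx, rfl⟩
    rw [mem_closedBall_zero_iff] at hx ⊢
    exact (A.le_opNorm x).trans (mul_le_of_le_one_right (norm_nonneg _) hx)
  have hK : IsCompact (A '' closedBall 0 1) := (isCompact_closedBall 0 1).image A.continuous
  have h2 : μ (A '' closedBall 0 1) = μ (closedBall 0 ‖A‖) := by
    rw [Measure.addHaar_image_continuousLinearMap,
      Measure.addHaar_closedBall' μ 0 (norm_nonneg A), ← hA]
  have h3 : μ (closedBall 0 ‖A‖ \ A '' closedBall 0 1) = 0 := by
    rw [measure_sdiff h1 hK.measurableSet.nullMeasurableSet hK.measure_lt_top.ne, h2,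
      tsub_self]
  -- The part of the open ball missed by the compact image is open and null, hence empty.
  have h4 : ball 0 ‖A‖ ⊆ A '' closedBall 0 1 := by
    have : ball (0 : E) ‖A‖ \ A '' closedBall 0 1 = ∅ :=
      (isOpen_ball.sdiff hK.isClosed).eq_empty_of_measure_zero
        (measure_mono_null (sdiff_subset_sdiff_left ball_subset_closedBall) h3)
    exact sdiff_eq_empty.1 this
  have hdet : A.det ≠ 0 := by
    intro h
    rw [h, abs_zero] at hA
    exact (pow_pos hc _).ne' hA
  have hinj : Function.Injective A :=
    (A.toContinuousLinearEquivOfDetNeZero hdet).injective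
  refine le_antisymm (A.le_opNorm v) (not_lt.1 fun hlt => ?_)
  have hv : 0 < ‖v‖ := by
    rcases eq_or_ne v 0 with rfl | hv
    · simp at hlt
    · exact norm_pos_iff.2 hv
  -- With `‖A v‖ / ‖v‖ < q < ‖A‖`, the multiple of `v` of norm `‖A‖ / q > 1` is mapped into the ball
  -- of radius `‖A‖`. That ball is already covered by the image of the unit ball, against
  -- injectivity.
  obtain ⟨q, hq1, hq2⟩ := exists_between ((div_lt_iff₀ hv).2 hlt)
  have hq : 0 < q := lt_of_le_of_lt (by positivity) hq1
  have hq1' : ‖A v‖ < q * ‖v‖ := (div_lt_iff₀ hv).1 hq1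
  have hs : A ((‖A‖ / (q * ‖v‖)) • v) ∈ ball 0 ‖A‖ := by
    rw [mem_ball_zero_iff, map_smul, norm_smul, Real.norm_of_nonneg (by positivity),
      div_mul_eq_mul_div, div_lt_iff₀ (by positivity)]
    exact mul_lt_mul_of_pos_left hq1' hc
  obtain ⟨b, hb, hbe⟩ := h4 hs
  rw [hinj hbe, mem_closedBall_zero_iff, norm_smul, Real.norm_of_nonneg (by positivity),
    div_mul_eq_mul_div, div_le_one (by positivity)] at hb
  exact absurd (le_of_mul_le_mul_right hb hv) (not_le.2 hq2)

end Linear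

/-! ### Open mapping without continuity of the derivative -/

section Open

variable {E : Type*} [NormedAddCommGroup E] [InnerProductSpace ℝ E] [FiniteDimensional ℝ E]

/-- The derivative need not be continuous, so the inverse function theorem is replaced by a
variational argument: for `y` near `f x`, minimise `‖f z - y‖²` over a closed ball. Injectivity
keeps the minimiser off the sphere, and at an interior minimum surjectivity of the derivative forces
`f z = y`. -/
theorem isOpen_image_of_injOn_of_injective_fderiv {f : E → E} {U : Set E} (hU : IsOpen U)
    (hf : InjOn f U) (hd : ∀ x ∈ U, DifferentiableAt ℝ f x)
    (hi : ∀ x ∈ U, Function.Injective (fderiv ℝ f x)) : IsOpen (f '' U) := by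
  rw [isOpen_iff_mem_nhds]
  rintro _ ⟨x, hx, rfl⟩
  obtain ⟨r, hr, hrU⟩ := nhds_basis_closedBall.mem_iff.1 (hU.mem_nhds hx)
  have hcont : ContinuousOn f U := fun z hz => (hd z hz).continuousAt.continuousWithinAt
  have hsU : sphere x r ⊆ U := sphere_subset_closedBall.trans hrU
  obtain ⟨m, hm, hms⟩ := (isCompact_sphere x r).exists_forall_le' (a := 0)
    (f := fun z => ‖f z - f x‖) ((hcont.mono hsU).sub continuousOn_const).norm (by
      intro z hz
      rw [norm_pos_iff, sub_ne_zero]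
      intro h
      have := hf (hsU hz) hx h
      rw [this, mem_sphere, dist_self] at hz
      exact hr.ne hz)
  refine mem_of_superset (ball_mem_nhds (f x) (half_pos hm)) fun y hy => ?_
  obtain ⟨z, hz, hzm⟩ := (isCompact_closedBall x r).exists_isMinOn
    ⟨x, mem_closedBall_self hr.le⟩
    (f := fun z => ‖f z - y‖ ^ 2) (((hcont.mono hrU).sub continuousOn_const).norm.pow 2)
  have hzx : ‖f z - y‖ ≤ ‖f x - y‖ :=
    le_of_sq_le_sq (hzm (mem_closedBall_self hr.le)) (norm_nonneg _)
  rw [mem_ball, dist_comm, dist_eq_norm] at hy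
  have hzb : z ∈ ball x r := by
    rw [mem_ball]
    refine lt_of_le_of_ne hz fun h => ?_
    have h1 := hms z h
    have h2 := norm_sub_le_norm_sub_add_norm_sub (f z) y (f x)
    rw [norm_sub_rev y] at h2
    linarith
  have hloc : IsLocalMin (fun z => ‖f z - y‖ ^ 2) z :=
    (hzm.on_subset ball_subset_closedBall).isLocalMin (isOpen_ball.mem_nhds hzb)
  have hder := ((hd z (hrU hz)).hasFDerivAt.sub_const y).norm_sq
  have h0 := hloc.hasFDerivAt_eq_zero hder
  -- Testing the vanishing derivative of the squared distance on a preimage `v` of `f z - y` gives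
  -- `2 ‖f z - y‖² = 0`.
  obtain ⟨v, hv⟩ := (LinearMap.injective_iff_surjective (f := (fderiv ℝ f z).toLinearMap)).1
    (hi z (hrU hz)) (f z - y)
  have h1 := congrArg (fun L : E →L[ℝ] ℝ => L v) h0
  have hv' : fderiv ℝ f z v = f z - y := hv
  simp only [smul_apply, ContinuousLinearMap.comp_apply, hv',
    innerSL_apply_apply, real_inner_self_eq_norm_sq, zero_apply] at h1
  have h2 : ‖f z - y‖ = 0 := by simpa using h1
  rw [norm_eq_zero] at h2
  exact ⟨z, hrU hz, sub_eq_zero.1 h2⟩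

end Open

/-! ### Lipschitz maps with almost everywhere vanishing derivative -/

section Constant

variable {E : Type*} [NormedAddCommGroup E] [NormedSpace ℝ E] [FiniteDimensional ℝ E]
  [MeasurableSpace E] [BorelSpace E]

/-- Fubini: for each fixed `s` the translate of a null set is null, and the two quantifiers may be
exchanged on a measurable null superset. -/
theorem ae_ae_add_smul_of_ae (μ : Measure E) [μ.IsAddHaarMeasure]
    {p : E → Prop} (h : ∀ᵐ x ∂μ, p x) (v : E) :
    ∀ᵐ x ∂μ, ∀ᵐ s : ℝ, p (x + s • v) := by
  obtain ⟨N, hN, hNm, hN0⟩ := exists_measurable_superset_of_null h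
  suffices ∀ᵐ x ∂μ, ∀ᵐ s : ℝ, x + s • v ∉ N by
    filter_upwards [this] with x hx
    filter_upwards [hx] with s hs
    by_contra hp
    exact hs (hN hp)
  rw [Measure.ae_ae_comm]
  · refine Eventually.of_forall fun s => ?_
    have := (measurePreserving_add_right μ (s • v)).quasiMeasurePreserving.ae
      (p := fun y => y ∉ N) (measure_eq_zero_iff_ae_notMem.1 hN0)
    exact this
  · exact (by fun_prop : Measurable fun x : E × ℝ => x.1 + x.2 • v) hNm.compl

/-- A Lipschitz function whose derivative vanishes almost everywhere on a connected open set is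
constant there. -/
theorem eqOn_const_of_ae_hasFDerivAt_zero (μ : Measure E) [μ.IsAddHaarMeasure]
    {f : E → E} {U : Set E} (hU : IsOpen U) (hUc : IsPreconnected U) {C : ℝ≥0} (hf : LipschitzOnWith C f U)
    (h0 : ∀ᵐ x ∂μ, x ∈ U → HasFDerivAt f (0 : E →L[ℝ] E) x) {x y : E} (hx : x ∈ U)
    (hy : y ∈ U) : f x = f y := by
  have hloc : ∀ x ∈ U, ∀ᶠ y in 𝓝 x, f y = f x := by
    intro x hx
    obtain ⟨r, hr, hrU⟩ := Metric.isOpen_iff.1 hU x hx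
    filter_upwards [ball_mem_nhds x (half_pos hr)] with y hy
    set v := y - x with hv
    have hvn : ‖v‖ < r / 2 := by rwa [mem_ball, dist_eq_norm] at hy
    have hmem : ∀ z ∈ ball x (r / 2), ∀ s ∈ uIcc (0 : ℝ) 1, z + s • v ∈ U := by
      intro z hz s hs
      rw [uIcc_of_le zero_le_one] at hs
      refine hrU ?_
      rw [mem_ball, dist_eq_norm] at hz ⊢
      calc ‖z + s • v - x‖ = ‖(z - x) + s • v‖ := by congr 1; abel
        _ ≤ ‖z - x‖ + ‖s • v‖ := norm_add_le _ _
        _ ≤ ‖z - x‖ + ‖v‖ := by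
          gcongr
          rw [norm_smul, Real.norm_of_nonneg hs.1]
          exact mul_le_of_le_one_left (norm_nonneg _) hs.2
        _ < r := by linarith
    -- On almost every segment in direction `v` the derivative vanishes almost everywhere, and a
    -- Lipschitz function of one variable is then constant. The segment starting at `x` itself may
    -- be exceptional; it is reached afterwards by density and continuity.
    have hae : ∀ᵐ z ∂μ, z ∈ ball x (r / 2) → f (z + v) = f z := by
      filter_upwards [ae_ae_add_smul_of_ae μ h0 v] with z hz hzb
      have hlip : LipschitzOnWith (C * ‖v‖₊) (fun s : ℝ => f (z + s • v)) (uIcc 0 1) := by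
        refine hf.comp (g := f) (f := fun s : ℝ => z + s • v) (K := ‖v‖₊) ?_
          (fun s hs => hmem z hzb s hs)
        refine LipschitzOnWith.of_dist_le_mul fun a _ b _ => ?_
        rw [dist_add_left, dist_eq_norm, ← sub_smul, norm_smul, mul_comm, coe_nnnorm,
          Real.dist_eq, Real.norm_eq_abs]
      obtain ⟨c, hc⟩ := hlip.absolutelyContinuousOnInterval.const_of_ae_hasDerivAt_zero (by
        filter_upwards [hz] with s hs hsI
        have h1 : HasDerivAt (fun s : ℝ => z + s • v) v s := by
          simpa using ((hasDerivAt_id s).smul_const v).const_add z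
        exact (hs (hmem z hzb s hsI)).comp_hasDerivAt s h1)
      have e0 := hc 0 (by simp)
      have e1 := hc 1 (by simp)
      simp only [zero_smul, add_zero, one_smul] at e0 e1
      rw [e0, e1]
    have hcl : x ∈ closure ({z | z ∈ ball x (r / 2) → f (z + v) = f z} ∩ ball x (r / 2)) := by
      have hd : Dense {z | z ∈ ball x (r / 2) → f (z + v) = f z} := Measure.dense_of_ae hae
      rw [inter_comm]
      exact hd.open_subset_closure_inter isOpen_ball (mem_ball_self (half_pos hr))
    have hcont : ContinuousAt (fun z => f (z + v) - f z) x := by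
      refine ContinuousAt.sub ?_ (hf.continuousOn.continuousAt (hU.mem_nhds hx))
      have : x + v ∈ U := by simpa using hmem x (mem_ball_self (half_pos hr)) 1 (by simp)
      exact ContinuousAt.comp (f := fun z => z + v)
        (hf.continuousOn.continuousAt (hU.mem_nhds this)) (by fun_prop)
    have hfr := mem_closure_iff_frequently.1 hcl
    have h1 : (fun z => f (z + v) - f z) x ∈ closure {(0 : E)} :=
      mem_closure_of_frequently_of_tendsto (hfr.mono fun z hz => by
        simp [hz.1 hz.2]) hcont
    rw [closure_singleton, mem_singleton_iff, sub_eq_zero] at h1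
    rw [← h1, hv]
    simp
  refine hUc.induction₂' (fun x y => f x = f y) ?_ (fun a b c _ _ _ h1 h2 => h1.trans h2) hx hy
  intro x hx
  filter_upwards [(hloc x hx).filter_mono nhdsWithin_le_nhds] with y hy
  exact ⟨hy.symm, hy⟩

end Constant
end SingleMap

/-! ### From conformality almost everywhere to conformality everywhere -/

section Conformal

open Module Metric
open scoped Pointwise

variable {E : Type*} [NormedAddCommGroup E] [NormedSpace ℝ E] [FiniteDimensional ℝ E]
  [MeasurableSpace E] [BorelSpace E]

/-- The fundamental theorem of calculus for a derivative that is measurable and bounded but perhaps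
discontinuous; `L` serves only to make it integrable. -/
theorem enorm_sub_le_lintegral_fderiv {f : E → E} {y v : E} {h L : ℝ} (hh : 0 ≤ h)
    (hv : ‖v‖ ≤ 1)
    (hd : ∀ s ∈ Icc 0 h, DifferentiableAt ℝ f (y + s • v))
    (hL : ∀ s ∈ Icc 0 h, ‖fderiv ℝ f (y + s • v)‖ ≤ L) :
    ‖f (y + h • v) - f y‖ₑ ≤ ∫⁻ s in Ioc 0 h, ‖fderiv ℝ f (y + s • v)‖ₑ := by
  have hder : ∀ s ∈ uIcc 0 h,
      HasDerivAt (fun s : ℝ => f (y + s • v)) (fderiv ℝ f (y + s • v) v) s := by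
    intro s hs
    rw [uIcc_of_le hh] at hs
    have h1 : HasDerivAt (fun s : ℝ => y + s • v) v s := by
      simpa using ((hasDerivAt_id s).smul_const v).const_add y
    exact (hd s hs).hasFDerivAt.comp_hasDerivAt s h1
  have hmeas : Measurable fun s : ℝ => fderiv ℝ f (y + s • v) v :=
    (measurable_fderiv_apply_const ℝ f v).comp (by fun_prop)
  have hle : ∀ s ∈ Icc 0 h, ‖fderiv ℝ f (y + s • v) v‖ ≤ ‖fderiv ℝ f (y + s • v)‖ :=
    fun s _ => (ContinuousLinearMap.le_opNorm _ v).trans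
      (mul_le_of_le_one_right (norm_nonneg _) hv)
  have hint : IntervalIntegrable (fun s : ℝ => fderiv ℝ f (y + s • v) v) volume 0 h := by
    rw [intervalIntegrable_iff_integrableOn_Ioc_of_le hh]
    refine IntegrableOn.of_bound (by simp) hmeas.aestronglyMeasurable L ?_
    filter_upwards [ae_restrict_mem measurableSet_Ioc] with s hs
    exact (hle s (Ioc_subset_Icc_self hs)).trans (hL s (Ioc_subset_Icc_self hs))
  have hftc := intervalIntegral.integral_eq_sub_of_hasDerivAt hder hint
  simp only [zero_smul, add_zero] at hftc
  rw [← hftc, intervalIntegral.integral_of_le hh]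
  refine (enorm_integral_le_lintegral_enorm _).trans (setLIntegral_mono' measurableSet_Ioc ?_)
  intro s hs
  exact enorm_le_iff_norm_le.2 (hle s (Ioc_subset_Icc_self hs))

/-- Averaging over the starting point turns the integral along a segment into a volume integral, by
Tonelli and translation invariance. The averaged derivative can then be controlled through volumes.
-/
theorem lintegral_enorm_sub_le (μ : Measure E) [μ.IsAddHaarMeasure] {f : E → E} {x v : E}
    {r h L : ℝ} (hh : 0 ≤ h) (hv : ‖v‖ ≤ 1)
    (hd : ∀ z ∈ closedBall x (r + h), DifferentiableAt ℝ f z)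
    (hL : ∀ z ∈ closedBall x (r + h), ‖fderiv ℝ f z‖ ≤ L) :
    ∫⁻ y in closedBall x r, ‖f (y + h • v) - f y‖ₑ ∂μ ≤
      ENNReal.ofReal h * ∫⁻ z in closedBall x (r + h), ‖fderiv ℝ f z‖ₑ ∂μ := by
  have hmem : ∀ y ∈ closedBall x r, ∀ s ∈ Icc 0 h, y + s • v ∈ closedBall x (r + h) := by
    intro y hy s hs
    rw [mem_closedBall, dist_eq_norm] at hy ⊢
    calc ‖y + s • v - x‖ = ‖(y - x) + s • v‖ := by congr 1; abel
      _ ≤ ‖y - x‖ + ‖s • v‖ := norm_add_le _ _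
      _ ≤ r + h := by
        refine add_le_add hy ?_
        rw [norm_smul, Real.norm_of_nonneg hs.1]
        exact (mul_le_of_le_one_right hs.1 hv).trans hs.2
  calc ∫⁻ y in closedBall x r, ‖f (y + h • v) - f y‖ₑ ∂μ
      ≤ ∫⁻ y in closedBall x r, (∫⁻ s in Ioc 0 h, ‖fderiv ℝ f (y + s • v)‖ₑ) ∂μ :=
        setLIntegral_mono' measurableSet_closedBall fun y hy =>
          enorm_sub_le_lintegral_fderiv hh hv (fun s hs => hd _ (hmem y hy s hs))
            (fun s hs => hL _ (hmem y hy s hs))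
    _ = ∫⁻ s in Ioc 0 h, ∫⁻ y in closedBall x r, ‖fderiv ℝ f (y + s • v)‖ₑ ∂μ := by
        refine lintegral_lintegral_swap (Measurable.aemeasurable ?_)
        exact ((measurable_fderiv ℝ f).enorm).comp
          (by fun_prop : Measurable fun p : E × ℝ => p.1 + p.2 • v)
    _ ≤ ∫⁻ s in Ioc 0 h, ∫⁻ z in closedBall x (r + h), ‖fderiv ℝ f z‖ₑ ∂μ := by
        refine setLIntegral_mono' measurableSet_Ioc fun s hs => ?_
        have hmp := (measurePreserving_add_right μ (s • v))
        rw [← hmp.setLIntegral_comp_preimage measurableSet_closedBall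
          (measurable_fderiv ℝ f).enorm]
        exact lintegral_mono_set fun y hy => hmem y hy s (Ioc_subset_Icc_self hs)
    _ = _ := by
        rw [setLIntegral_const, Real.volume_Ioc, sub_zero, mul_comm]

/-- If the mean of the `n`-th power is at most `c ^ n`, then the mean is at most `c`. -/
theorem lintegral_enorm_le_of_lintegral_pow_le {α : Type*} [MeasurableSpace α] (μ : Measure α)
    {F : Type*} [NormedAddCommGroup F] {g : α → F} {B : Set α} {c : ℝ} (hc : 0 < c)
    {n : ℕ} (hn : n ≠ 0)
    (h : ∫⁻ z in B, ENNReal.ofReal (‖g z‖ ^ n) ∂μ ≤ ENNReal.ofReal (c ^ n) * μ B) :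
    ∫⁻ z in B, ‖g z‖ₑ ∂μ ≤ ENNReal.ofReal c * μ B := by
  obtain ⟨k, rfl⟩ := Nat.exists_eq_succ_of_ne_zero hn
  -- The tangent line of `y ^ (k + 1)` at `c`, obtained from Bernoulli's inequality. Integrating it
  -- replaces Jensen and requires no integrability.
  have hpt : ∀ y : ℝ, 0 ≤ y → ((k : ℝ) + 1) * c ^ k * y ≤ k * c ^ (k + 1) + y ^ (k + 1) := by
    intro y hy
    have h1 := one_add_mul_le_pow (a := y / c - 1)
      (by have : 0 ≤ y / c := by positivity
          linarith) (k + 1)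
    rw [add_sub_cancel, div_pow, le_div_iff₀ (by positivity)] at h1
    push_cast at h1
    have h2 : (1 + ((k : ℝ) + 1) * (y / c - 1)) * c ^ (k + 1)
        = ((k : ℝ) + 1) * c ^ k * y - k * c ^ (k + 1) := by
      field_simp
      ring
    linarith
  have hkey : ENNReal.ofReal (((k : ℝ) + 1) * c ^ k) * ∫⁻ z in B, ‖g z‖ₑ ∂μ
      ≤ ENNReal.ofReal (((k : ℝ) + 1) * c ^ k) * (ENNReal.ofReal c * μ B) := by
    rw [← lintegral_const_mul' _ _ ENNReal.ofReal_ne_top]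
    calc ∫⁻ z in B, ENNReal.ofReal (((k : ℝ) + 1) * c ^ k) * ‖g z‖ₑ ∂μ
        ≤ ∫⁻ z in B, (ENNReal.ofReal (k * c ^ (k + 1)) + ENNReal.ofReal (‖g z‖ ^ (k + 1))) ∂μ := by
          refine lintegral_mono fun z => ?_
          rw [← ofReal_norm, ← ENNReal.ofReal_mul (by positivity),
            ← ENNReal.ofReal_add (by positivity) (by positivity)]
          exact ENNReal.ofReal_le_ofReal (hpt _ (norm_nonneg _))
      _ = ENNReal.ofReal (k * c ^ (k + 1)) * μ B
          + ∫⁻ z in B, ENNReal.ofReal (‖g z‖ ^ (k + 1)) ∂μ := by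
          rw [lintegral_add_left measurable_const, setLIntegral_const]
      _ ≤ ENNReal.ofReal (k * c ^ (k + 1)) * μ B + ENNReal.ofReal (c ^ (k + 1)) * μ B := by
          gcongr
      _ = _ := by
          rw [← add_mul, ← ENNReal.ofReal_add (by positivity) (by positivity), ← mul_assoc,
            ← ENNReal.ofReal_mul (by positivity)]
          congr 2
          ring_nf
  exact (ENNReal.mul_le_mul_iff_right (by simpa using by positivity) ENNReal.ofReal_ne_top).1 hkey

/-- If `f` is differentiable at `x`, then it expands the volume of small balls around `x` by a
factor which is asymptotically at most `|det f'(x)|`. -/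
theorem eventually_measure_image_closedBall_le (μ : Measure E) [μ.IsAddHaarMeasure] {f : E → E}
    {x : E} (hf : DifferentiableAt ℝ f x) {D : ℝ} (hD : |(fderiv ℝ f x).det| < D) :
    ∀ᶠ r in 𝓝[>] (0 : ℝ),
      μ (f '' closedBall x r) ≤ ENNReal.ofReal D * μ (closedBall x r) := by
  set A := fderiv ℝ f x with hA
  have hK : IsCompact (A '' closedBall 0 1) := (isCompact_closedBall 0 1).image A.continuous
  have hlt : μ (A '' closedBall 0 1) < ENNReal.ofReal D * μ (closedBall (0 : E) 1) := by
    rw [Measure.addHaar_image_continuousLinearMap]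
    exact (ENNReal.mul_lt_mul_iff_left (measure_closedBall_pos μ (0 : E) one_pos).ne'
      measure_closedBall_lt_top.ne).2
      ((ENNReal.ofReal_lt_ofReal_iff ((abs_nonneg _).trans_lt hD)).2 hD)
  -- A thickening of `A(B)` still has volume below `D` times that of the unit ball `B`;
  -- differentiability puts the rescaled image of a small ball inside it.
  obtain ⟨ε, hε, hεpos⟩ := (((tendsto_measure_cthickening_of_isCompact
    (μ := μ) hK).eventually_lt_const hlt).filter_mono nhdsWithin_le_nhds |>.and
      (self_mem_nhdsWithin : Ioi (0 : ℝ) ∈ 𝓝[>] 0)).exists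
  have hεpos : 0 < ε := hεpos
  have happ := hf.hasFDerivAt.isLittleO.def hεpos
  obtain ⟨δ, hδ, hδb⟩ := Metric.eventually_nhds_iff.1 happ
  filter_upwards [Ioo_mem_nhdsGT hδ] with r hr
  have hr0 : 0 < r := hr.1
  have hsub : f '' closedBall x r ⊆
      (fun z => f x + z) '' (r • cthickening ε (A '' closedBall 0 1)) := by
    rintro _ ⟨y, hy, rfl⟩
    rw [mem_closedBall] at hy
    have h1 := hδb (lt_of_le_of_lt hy hr.2)
    rw [dist_eq_norm] at hy
    refine ⟨f y - f x, ?_, by simp⟩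
    rw [mem_smul_set_iff_inv_smul_mem₀ hr0.ne']
    refine mem_cthickening_of_dist_le _ (A (r⁻¹ • (y - x))) _ _ ⟨_, ?_, rfl⟩ ?_
    · rw [mem_closedBall_zero_iff, norm_smul, norm_inv, Real.norm_of_nonneg hr0.le]
      exact inv_mul_le_one_of_le₀ hy hr0.le
    · rw [map_smul, dist_eq_norm, ← smul_sub, norm_smul, norm_inv, Real.norm_of_nonneg hr0.le,
        inv_mul_le_iff₀ hr0]
      calc ‖f y - f x - A (y - x)‖ ≤ ε * ‖y - x‖ := h1
        _ ≤ r * ε := by rw [mul_comm]; gcongr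
  calc μ (f '' closedBall x r) ≤ _ := measure_mono hsub
    _ = μ (r • cthickening ε (A '' closedBall 0 1)) := by
        rw [image_add_left, measure_preimage_add]
    _ = ENNReal.ofReal (r ^ finrank ℝ E) * μ (cthickening ε (A '' closedBall 0 1)) := by
        rw [Measure.addHaar_smul, abs_of_nonneg (by positivity)]
    _ ≤ ENNReal.ofReal (r ^ finrank ℝ E) * (ENNReal.ofReal D * μ (closedBall (0 : E) 1)) := by
        gcongr
    _ = _ := by
        rw [Measure.addHaar_closedBall' μ x hr0.le]
        ring

/-- Conformality almost everywhere implies conformality everywhere, for injective differentiable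
maps. -/
theorem opNorm_fderiv_pow_eq_abs_det_of_ae (μ : Measure E) [μ.IsAddHaarMeasure] {f : E → E}
    {U : Set E} (hU : IsOpen U) (hd : ∀ x ∈ U, DifferentiableAt ℝ f x) (hinj : InjOn f U)
    {L : ℝ} (hL : ∀ x ∈ U, ‖fderiv ℝ f x‖ ≤ L)
    (hc : ∀ᵐ x ∂μ.restrict U, ‖fderiv ℝ f x‖ ^ finrank ℝ E = |(fderiv ℝ f x).det|)
    {x : E} (hx : x ∈ U) : ‖fderiv ℝ f x‖ ^ finrank ℝ E = |(fderiv ℝ f x).det| := by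
  refine le_antisymm ?_ (abs_det_le_opNorm_pow μ _)
  rcases eq_or_ne (finrank ℝ E) 0 with hn | hn
  · rw [hn, pow_zero, ContinuousLinearMap.det, LinearMap.det_eq_one_of_finrank_eq_zero hn, abs_one]
  set A := fderiv ℝ f x with hA
  set n := finrank ℝ E
  -- If the norm were too large, a `c` slightly below `‖A‖` would contradict this bound.
  suffices hv : ∀ c : ℝ, 0 < c → |A.det| < c ^ n → ∀ v : E, ‖v‖ = 1 → ‖A v‖ ≤ c by
    by_contra! hlt
    obtain ⟨c, hc0, hc1, hc2⟩ : ∃ c : ℝ, 0 < c ∧ |A.det| < c ^ n ∧ c < ‖A‖ := by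
      have h1 : ∀ᶠ c in 𝓝[<] ‖A‖, |A.det| < c ^ n :=
        ((continuous_pow n).tendsto ‖A‖ |>.eventually_const_lt hlt).filter_mono
          nhdsWithin_le_nhds
      have hA0 : 0 < ‖A‖ := by
        by_contra! h0
        have : ‖A‖ = 0 := le_antisymm h0 (norm_nonneg _)
        rw [this, zero_pow hn] at hlt
        exact absurd hlt (not_lt.2 (abs_nonneg _))
      obtain ⟨c, h2, h3⟩ := (h1.and (Ioo_mem_nhdsLT hA0)).exists
      exact ⟨c, h3.1, h2, h3.2⟩
    refine absurd (A.opNorm_le_of_unit_norm hc0.le fun v hv' => ?_) (not_le.2 hc2)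
    exact hv c hc0 hc1 v hv'
  intro c hc0 hdet v hv1
  -- mean value estimate at scale `r` with step `η r`
  have hstep : ∀ η : ℝ, 0 < η → ∀ ε : ℝ, 0 < ε →
      η * ‖A v‖ - ε ≤ η * c * (1 + η) ^ n := by
    intro η hη ε hε
    -- The linearisation is used at both `y` and `y + η r v`, which lie within `R = (1 + η) r` of
    -- `x`; with this constant each error is at most `ε r / 2`.
    have happ := (hd x hx).hasFDerivAt.isLittleO.def
      (show 0 < ε / (2 * (1 + η)) by positivity)
    obtain ⟨δ, hδ, hδb⟩ := Metric.eventually_nhds_iff.1 happ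
    obtain ⟨ρ, hρ, hρU⟩ := nhds_basis_closedBall.mem_iff.1 (hU.mem_nhds hx)
    have hvol := (eventually_measure_image_closedBall_le μ (hd x hx) hdet)
    obtain ⟨R, hRv, hR0, hRδ⟩ :=
      (hvol.and (Ioo_mem_nhdsGT (lt_min hδ hρ))).exists
    have hR0 : 0 < R := hR0
    have hRU : closedBall x R ⊆ U :=
      (closedBall_subset_closedBall (hRδ.le.trans (min_le_right _ _))).trans hρU
    set r := R / (1 + η) with hr
    have hr0 : 0 < r := by positivity
    have hRr : R = r + η * r := by rw [hr]; field_simp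
    -- Almost everywhere conformality turns the integral of the `n`-th power of the norm into the
    -- volume of the image, which the Jacobian at the single point `x` controls.
    have hmean : ∫⁻ z in closedBall x R, ‖fderiv ℝ f z‖ₑ ∂μ
        ≤ ENNReal.ofReal c * μ (closedBall x R) := by
      refine lintegral_enorm_le_of_lintegral_pow_le μ hc0 hn ?_
      calc ∫⁻ z in closedBall x R, ENNReal.ofReal (‖fderiv ℝ f z‖ ^ n) ∂μ
          = ∫⁻ z in closedBall x R, ENNReal.ofReal |(fderiv ℝ f z).det| ∂μ := by
            refine lintegral_congr_ae ?_
            filter_upwards [ae_mono (Measure.restrict_mono hRU le_rfl) hc] with z hz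
            rw [hz]
        _ = μ (f '' closedBall x R) :=
            lintegral_abs_det_fderiv_eq_addHaar_image μ measurableSet_closedBall
              (fun z hz => (hd z (hRU hz)).hasFDerivAt.hasFDerivWithinAt) (hinj.mono hRU)
        _ ≤ _ := hRv
    have hint := lintegral_enorm_sub_le μ (f := f) (x := x) (v := v) (r := r) (h := η * r) (L := L)
      (by positivity) hv1.le
      (fun z hz => hd z (hRU (by rwa [hRr]))) (fun z hz => hL z (hRU (by rwa [hRr])))
    rw [← hRr] at hint
    have hlow : ENNReal.ofReal (r * (η * ‖A v‖ - ε)) * μ (closedBall x r) ≤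
        ∫⁻ y in closedBall x r, ‖f (y + (η * r) • v) - f y‖ₑ ∂μ := by
      rw [← setLIntegral_const]
      refine setLIntegral_mono' measurableSet_closedBall fun y hy => ?_
      rw [← ofReal_norm]
      refine ENNReal.ofReal_le_ofReal ?_
      have hyn : ‖y - x‖ ≤ r := by rwa [mem_closedBall, dist_eq_norm] at hy
      have hyR : dist y x < δ := by
        rw [dist_eq_norm]
        have : r ≤ R := by rw [hRr]; nlinarith
        exact (hyn.trans this).trans_lt (hRδ.trans_le (min_le_left _ _))
      have hywn : ‖y + (η * r) • v - x‖ ≤ R := by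
        calc ‖y + (η * r) • v - x‖ = ‖(y - x) + (η * r) • v‖ := by congr 1; abel
          _ ≤ ‖y - x‖ + ‖(η * r) • v‖ := norm_add_le _ _
          _ ≤ R := by
            rw [hRr, norm_smul, hv1, mul_one, Real.norm_of_nonneg (by positivity)]
            gcongr
      have h1 := hδb hyR
      have h2 := hδb (y := y + (η * r) • v) (by
        rw [dist_eq_norm]; exact hywn.trans_lt (hRδ.trans_le (min_le_left _ _)))
      have e1 : A ((η * r) • v) = (f (y + (η * r) • v) - f y)
          - (f (y + (η * r) • v) - f x - A (y + (η * r) • v - x)) + (f y - f x - A (y - x)) := by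
        have : A ((η * r) • v) = A (y + (η * r) • v - x) - A (y - x) := by
          rw [← map_sub]; congr 1; abel
        rw [this]; abel
      have e2 : ‖A ((η * r) • v)‖ = η * r * ‖A v‖ := by
        rw [map_smul, norm_smul, Real.norm_of_nonneg (by positivity)]
      have e3 : ‖A ((η * r) • v)‖ ≤ ‖f (y + (η * r) • v) - f y‖
          + ‖f (y + (η * r) • v) - f x - A (y + (η * r) • v - x)‖ + ‖f y - f x - A (y - x)‖ := by
        rw [e1]
        exact (norm_add_le _ _).trans (add_le_add_left (norm_sub_le _ _) _)
      have hyR' : ‖y - x‖ ≤ R := hyn.trans (by rw [hRr]; nlinarith)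
      have b1 : ε / (2 * (1 + η)) * ‖y - x‖ ≤ ε / (2 * (1 + η)) * R := by gcongr
      have b2 : ε / (2 * (1 + η)) * ‖y + (η * r) • v - x‖ ≤ ε / (2 * (1 + η)) * R := by gcongr
      have b3 : ε / (2 * (1 + η)) * R = ε * r / 2 := by rw [hr]; field_simp
      rw [e2] at e3
      linarith
    have hfin := hlow.trans (hint.trans (mul_le_mul_right hmean _))
    rw [Measure.addHaar_closedBall' μ x hr0.le, Measure.addHaar_closedBall' μ x hR0.le,
      ← mul_assoc, ← mul_assoc, ← mul_assoc, ← ENNReal.ofReal_mul' (by positivity),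
      ← ENNReal.ofReal_mul (by positivity), ← ENNReal.ofReal_mul (by positivity),
      ENNReal.mul_le_mul_iff_left (measure_closedBall_pos μ (0 : E) one_pos).ne'
        measure_closedBall_lt_top.ne, ENNReal.ofReal_le_ofReal_iff (by positivity)] at hfin
    have hRr' : R = r * (1 + η) := by rw [hRr]; ring
    rw [hRr', mul_pow] at hfin
    have hp : 0 < r * r ^ n := by positivity
    refine le_of_mul_le_mul_left ?_ hp
    calc r * r ^ n * (η * ‖A v‖ - ε) = r * (η * ‖A v‖ - ε) * r ^ n := by ring
      _ ≤ _ := hfin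
      _ = _ := by ring
  have hη : ∀ η : ℝ, 0 < η → ‖A v‖ ≤ c * (1 + η) ^ n := by
    intro η hη
    have : η * ‖A v‖ ≤ η * c * (1 + η) ^ n :=
      le_of_forall_pos_le_add fun ε hε => by linarith [hstep η hη ε hε]
    rw [mul_assoc] at this
    exact le_of_mul_le_mul_left this hη
  have hlim : Tendsto (fun η : ℝ => c * (1 + η) ^ n) (𝓝[>] 0) (𝓝 (c * (1 + 0) ^ n)) :=
    (Continuous.tendsto (by fun_prop) 0).mono_left nhdsWithin_le_nhds
  have := ge_of_tendsto hlim (by filter_upwards [self_mem_nhdsWithin] with η h using hη η h)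
  simpa using this

end Conformal

/-! ### Words and incomparability -/

section Words

variable {I α : Type*}

theorem wordMap_append (φ : I → α → α) (u v : List I) :
    wordMap φ (u ++ v) = wordMap φ u ∘ wordMap φ v := by
  induction u with
  | nil => rfl
  | cons i u ih => simp only [List.cons_append, wordMap, ih, Function.comp_assoc]

theorem mapsTo_wordMap {φ : I → α → α} {A : Set α} (h : ∀ i, MapsTo (φ i) A A) (w : List I) :
    MapsTo (wordMap φ w) A A := by
  induction w with
  | nil => exact mapsTo_id A
  | cons i w ih => exact (h i).comp ih

theorem injOn_wordMap {φ : I → α → α} {A : Set α} (h : ∀ i, MapsTo (φ i) A A)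
    (hi : ∀ i, InjOn (φ i) A) (w : List I) : InjOn (wordMap φ w) A := by
  induction w with
  | nil => exact injOn_id A
  | cons i w ih => exact (hi i).comp ih (mapsTo_wordMap h w)

/-- Two words are incomparable if neither is a prefix of the other. -/
def Incomparable (u v : List I) : Prop := ¬ u <+: v ∧ ¬ v <+: u

theorem Incomparable.symm {u v : List I} (h : Incomparable u v) : Incomparable v u := ⟨h.2, h.1⟩

theorem Incomparable.append_left {u v : List I} (w : List I) (h : Incomparable u v) :
    Incomparable (w ++ u) (w ++ v) := by
  simpa only [Incomparable, List.prefix_append_right_inj] using h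

theorem Incomparable.append_right {u v : List I} (h : Incomparable u v) (w : List I) :
    Incomparable (u ++ w) v := by
  refine ⟨fun h' => h.1 ((List.prefix_append u w).trans h'), fun h' => ?_⟩
  rcases List.prefix_or_prefix_of_prefix h' (List.prefix_append u w) with h1 | h1
  exacts [h.2 h1, h.1 h1]

theorem incomparable_of_length_eq {u v : List I} (h : u.length = v.length) (hne : u ≠ v) :
    Incomparable u v :=
  ⟨fun h' => hne (h'.eq_of_length h), fun h' => hne (h'.eq_of_length h.symm).symm⟩

/-- Injectivity strips the common prefix; at the first differing letter the one-step disjointness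
applies. -/
theorem disjoint_wordMap_image {φ : I → α → α} {A B : Set α} (hAB : A ⊆ B)
    (hA : ∀ i, MapsTo (φ i) A A)
    (hi : ∀ i, InjOn (φ i) B)
    (hd : ∀ i j, i ≠ j → Disjoint (φ i '' A) (φ j '' A)) {u v : List I}
    (h : Incomparable u v) : Disjoint (wordMap φ u '' A) (wordMap φ v '' A) := by
  induction u generalizing v with
  | nil => exact absurd List.nil_prefix h.1
  | cons i u ih =>
    cases v with
    | nil => exact absurd List.nil_prefix h.2
    | cons j v =>
      have hsub : ∀ w : List I, wordMap φ w '' A ⊆ A := fun w => (mapsTo_wordMap hA w).image_subset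
      rcases eq_or_ne i j with rfl | hij
      · have huv : Incomparable u v := by
          simpa only [Incomparable, List.cons_prefix_cons, true_and] using h
        simp only [wordMap, image_comp]
        rw [disjoint_left]
        rintro _ ⟨a, ha, rfl⟩ ⟨b, hb, hba⟩
        rw [hi i (hAB (hsub v hb)) (hAB (hsub u ha)) hba] at hb
        exact disjoint_left.1 (ih huv) ha hb
      · simp only [wordMap, image_comp]
        exact (hd i j hij).mono (image_mono (hsub u)) (image_mono (hsub v))

end Words

instance isAddHaarMeasure_hausdorffMeasure_euclideanSpace (d : ℕ) :
    (μH[(d : ℝ)] : Measure (EuclideanSpace ℝ (Fin d))).IsAddHaarMeasure := by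
  have h := isAddHaarMeasure_hausdorffMeasure (E := EuclideanSpace ℝ (Fin d))
  rwa [finrank_euclideanSpace_fin] at h

/-! ### Bounded distortion and the geometry of the maps `φ_w` -/

namespace CIFS

open Metric Module

variable {d : ℕ} {I : Type*} (S : CIFS d I)

/-- `S.F w` is the map `φ_w`. -/
abbrev F (w : List I) : EuclideanSpace ℝ (Fin d) → EuclideanSpace ℝ (Fin d) := wordMap S.φ w

theorem F_append (u v : List I) (x : EuclideanSpace ℝ (Fin d)) :
    S.F (u ++ v) x = S.F u (S.F v x) := by
  rw [F, wordMap_append]; rfl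

theorem mapsTo_F_Ω (w : List I) : MapsTo (S.F w) S.Ω S.Ω := mapsTo_wordMap S.mapsTo_Ω w

theorem mapsTo_F_X (w : List I) : MapsTo (S.F w) S.X S.X := mapsTo_wordMap S.mapsTo_X w

theorem injOn_F (w : List I) : InjOn (S.F w) S.Ω := injOn_wordMap S.mapsTo_Ω S.injOn_Ω w

theorem exists_contraction : ∃ s : ℝ, 0 ≤ s ∧ s < 1 ∧ ∀ w, ∀ x ∈ S.Ω, ∀ y ∈ S.Ω,
    ‖S.F w x - S.F w y‖ ≤ s ^ w.length * ‖x - y‖ := by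
  obtain ⟨s, hs, hL, hsup⟩ := S.uniformly_contractive
  have hb : BddAbove (range s) := ⟨1, by rintro _ ⟨i, rfl⟩; exact (hs i).2.le⟩
  have h0 : 0 ≤ ⨆ i, s i := Real.iSup_nonneg fun i => (hs i).1.le
  refine ⟨⨆ i, s i, h0, hsup, fun w => ?_⟩
  induction w with
  | nil => intro x _ y _; simp [F, wordMap]
  | cons i w ih =>
    intro x hx y hy
    calc ‖S.F (i :: w) x - S.F (i :: w) y‖
        ≤ s i * ‖S.F w x - S.F w y‖ := hL i _ (S.mapsTo_F_Ω w hx) _ (S.mapsTo_F_Ω w hy)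
      _ ≤ (⨆ i, s i) * ((⨆ i, s i) ^ w.length * ‖x - y‖) :=
          mul_le_mul (le_ciSup hb i) (ih x hx y hy) (norm_nonneg _) h0
      _ = _ := by rw [List.length_cons, pow_succ']; ring

/-- A common contraction ratio of the maps of the system. -/
noncomputable def s : ℝ := S.exists_contraction.choose

theorem s_nonneg : 0 ≤ S.s := S.exists_contraction.choose_spec.1

theorem s_lt_one : S.s < 1 := S.exists_contraction.choose_spec.2.1

theorem norm_F_sub_le (w : List I) {x y : EuclideanSpace ℝ (Fin d)} (hx : x ∈ S.Ω)
    (hy : y ∈ S.Ω) : ‖S.F w x - S.F w y‖ ≤ S.s ^ w.length * ‖x - y‖ :=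
  S.exists_contraction.choose_spec.2.2 w x hx y hy

theorem lipschitzOnWith_F (w : List I) : LipschitzOnWith (S.s ^ w.length).toNNReal (S.F w) S.Ω :=
  LipschitzOnWith.of_dist_le_mul fun x hx y hy => by
    rw [Real.coe_toNNReal _ (pow_nonneg S.s_nonneg _), dist_eq_norm, dist_eq_norm]
    exact S.norm_F_sub_le w hx hy

/-- The distortion constant of the system. -/
noncomputable def K : ℝ := S.bounded_distortion.choose

theorem one_le_K : 1 ≤ S.K := S.bounded_distortion.choose_spec.1

theorem K_pos : 0 < S.K := zero_lt_one.trans_le S.one_le_K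

theorem norm_fderiv_le_mul (w : List I) {x y : EuclideanSpace ℝ (Fin d)} (hx : x ∈ S.Ω)
    (hy : y ∈ S.Ω) : ‖fderiv ℝ (S.F w) x‖ ≤ S.K * ‖fderiv ℝ (S.F w) y‖ := by
  rcases eq_or_ne w [] with rfl | hw
  · have h : S.F [] = id := rfl
    rw [h, fderiv_id, fderiv_id]
    exact le_mul_of_one_le_left (norm_nonneg _) S.one_le_K
  · exact S.bounded_distortion.choose_spec.2 w hw x hx y hy

/-- A base point in the interior of `X`. -/
noncomputable def base : EuclideanSpace ℝ (Fin d) := S.nonempty_interior_X.choose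

theorem base_mem_interior : S.base ∈ interior S.X := S.nonempty_interior_X.choose_spec

theorem base_mem_X : S.base ∈ S.X := interior_subset S.base_mem_interior

theorem base_mem_Ω : S.base ∈ S.Ω := S.X_subset_Ω S.base_mem_X

/-- The contraction ratio of `φ_w` at the base point. -/
noncomputable def ratio (w : List I) : ℝ := ‖fderiv ℝ (S.F w) S.base‖

theorem norm_fderiv_le (w : List I) {x : EuclideanSpace ℝ (Fin d)} (hx : x ∈ S.Ω) :
    ‖fderiv ℝ (S.F w) x‖ ≤ S.K * S.ratio w := S.norm_fderiv_le_mul w hx S.base_mem_Ω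

theorem le_norm_fderiv (w : List I) {x : EuclideanSpace ℝ (Fin d)} (hx : x ∈ S.Ω) :
    S.ratio w / S.K ≤ ‖fderiv ℝ (S.F w) x‖ := by
  rw [div_le_iff₀' S.K_pos]
  exact S.norm_fderiv_le_mul w S.base_mem_Ω hx

/-- A zero at the base point spreads to all of `Ω` by bounded distortion. Since `φ_w` is
differentiable almost everywhere (Rademacher), it would have zero derivative almost everywhere and
be constant, against injectivity. -/
theorem ratio_pos (hd : 0 < d) (w : List I) : 0 < S.ratio w := by
  refine (norm_nonneg _).lt_of_ne' fun h0 => ?_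
  have hz : ∀ x ∈ S.Ω, fderiv ℝ (S.F w) x = 0 := fun x hx => by
    have := S.norm_fderiv_le w hx
    rw [ratio, h0, mul_zero] at this
    exact norm_le_zero_iff.1 this
  have hae : ∀ᵐ x ∂(volume : Measure (EuclideanSpace ℝ (Fin d))), x ∈ S.Ω →
      HasFDerivAt (S.F w) (0 : EuclideanSpace ℝ (Fin d) →L[ℝ] EuclideanSpace ℝ (Fin d)) x := by
    filter_upwards [(S.lipschitzOnWith_F w).ae_differentiableWithinAt_of_mem (μ := volume)]
      with x hx hxΩ
    have h1 := ((hx hxΩ).differentiableAt (S.isOpen_Ω.mem_nhds hxΩ)).hasFDerivAt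
    rwa [hz x hxΩ] at h1
  have : Nonempty (Fin d) := ⟨⟨0, hd⟩⟩
  have : Nontrivial (EuclideanSpace ℝ (Fin d)) := inferInstance
  obtain ⟨y, hyne, hy⟩ : ∃ y, y ≠ S.base ∧ y ∈ S.Ω := by
    have := (Module.punctured_nhds_neBot ℝ (EuclideanSpace ℝ (Fin d)) S.base)
    have h1 : ∀ᶠ y in 𝓝[≠] S.base, y ∈ S.Ω :=
      mem_nhdsWithin_of_mem_nhds (S.isOpen_Ω.mem_nhds S.base_mem_Ω)
    obtain ⟨y, h2, h3⟩ := (h1.and self_mem_nhdsWithin).exists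
    exact ⟨y, h3, h2⟩
  exact hyne (S.injOn_F w hy S.base_mem_Ω (eqOn_const_of_ae_hasFDerivAt_zero volume S.isOpen_Ω
    S.isConnected_Ω.isPreconnected (S.lipschitzOnWith_F w) hae hy S.base_mem_Ω))

theorem norm_fderiv_pos (hd : 0 < d) (w : List I) {x : EuclideanSpace ℝ (Fin d)} (hx : x ∈ S.Ω) :
    0 < ‖fderiv ℝ (S.F w) x‖ :=
  (div_pos (S.ratio_pos hd w) S.K_pos).trans_le (S.le_norm_fderiv w hx)

/-- A nonzero `fderiv` certifies differentiability, because its default value is zero. -/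
theorem differentiableAt_F (hd : 0 < d) (w : List I) {x : EuclideanSpace ℝ (Fin d)}
    (hx : x ∈ S.Ω) : DifferentiableAt ℝ (S.F w) x := by
  by_contra h
  have := S.norm_fderiv_pos hd w hx
  rw [fderiv_zero_of_not_differentiableAt h, norm_zero] at this
  exact lt_irrefl _ this

theorem continuousOn_F (w : List I) : ContinuousOn (S.F w) S.Ω :=
  (S.lipschitzOnWith_F w).continuousOn

theorem fderiv_F_append (hd : 0 < d) (u v : List I) {x : EuclideanSpace ℝ (Fin d)}
    (hx : x ∈ S.Ω) :
    fderiv ℝ (S.F (u ++ v)) x = (fderiv ℝ (S.F u) (S.F v x)).comp (fderiv ℝ (S.F v) x) := by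
  rw [F, wordMap_append]
  exact fderiv_comp x (S.differentiableAt_F hd u (S.mapsTo_F_Ω v hx)) (S.differentiableAt_F hd v hx)

theorem norm_fderiv_φ_apply (hd : 0 < d) (i : I) {x : EuclideanSpace ℝ (Fin d)} (hx : x ∈ S.Ω)
    (v : EuclideanSpace ℝ (Fin d)) : ‖fderiv ℝ (S.F [i]) x v‖ = ‖fderiv ℝ (S.F [i]) x‖ * ‖v‖ := by
  have hF : S.F [i] = S.φ i := rfl
  refine norm_apply_eq_of_opNorm_pow_eq_abs_det volume _ ?_ v
  refine opNorm_fderiv_pow_eq_abs_det_of_ae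
    (μH[(d : ℝ)] : Measure (EuclideanSpace ℝ (Fin d))) S.isOpen_Ω
    (fun x hx => S.differentiableAt_F hd [i] hx) (S.injOn_F [i])
    (L := S.K * S.ratio [i]) (fun x hx => S.norm_fderiv_le [i] hx) ?_ hx
  rw [hF, finrank_euclideanSpace_fin]
  exact S.conformal i

/-- The derivatives of all the maps `φ_w` are similarities. -/
theorem norm_fderiv_apply (hd : 0 < d) (w : List I) {x : EuclideanSpace ℝ (Fin d)} (hx : x ∈ S.Ω)
    (v : EuclideanSpace ℝ (Fin d)) : ‖fderiv ℝ (S.F w) x v‖ = ‖fderiv ℝ (S.F w) x‖ * ‖v‖ := by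
  have : Nonempty (Fin d) := ⟨⟨0, hd⟩⟩
  induction w generalizing v with
  | nil =>
    have h : S.F [] = id := rfl
    rw [h, fderiv_id]
    simp
  | cons i w ih =>
    have hx' := S.mapsTo_F_Ω w hx
    have h1 : ∀ v, ‖fderiv ℝ (S.F (i :: w)) x v‖ =
        ‖fderiv ℝ (S.F [i]) (S.F w x)‖ * ‖fderiv ℝ (S.F w) x‖ * ‖v‖ := by
      intro v
      rw [show i :: w = [i] ++ w from rfl, S.fderiv_F_append hd _ _ hx,
        ContinuousLinearMap.comp_apply, S.norm_fderiv_φ_apply hd i hx', ih, mul_assoc]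
    have h2 : ‖fderiv ℝ (S.F (i :: w)) x‖ =
        ‖fderiv ℝ (S.F [i]) (S.F w x)‖ * ‖fderiv ℝ (S.F w) x‖ := by
      obtain ⟨e, he⟩ := exists_norm_eq (EuclideanSpace ℝ (Fin d)) zero_le_one
      refine le_antisymm (ContinuousLinearMap.opNorm_le_bound _ (by positivity)
        fun v => (h1 v).le) ?_
      have := (fderiv ℝ (S.F (i :: w)) x).le_opNorm e
      rwa [h1 e, he, mul_one, mul_one] at this
    rw [h1, h2]

/-- Operator norms of similarities are multiplicative, so the chain rule holds for norms with
equality. -/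
theorem norm_fderiv_append (hd : 0 < d) (u v : List I) {x : EuclideanSpace ℝ (Fin d)}
    (hx : x ∈ S.Ω) :
    ‖fderiv ℝ (S.F (u ++ v)) x‖ = ‖fderiv ℝ (S.F u) (S.F v x)‖ * ‖fderiv ℝ (S.F v) x‖ := by
  have : Nonempty (Fin d) := ⟨⟨0, hd⟩⟩
  obtain ⟨e, he⟩ := exists_norm_eq (EuclideanSpace ℝ (Fin d)) zero_le_one
  have h := S.norm_fderiv_apply hd (u ++ v) hx e
  rw [S.fderiv_F_append hd u v hx, ContinuousLinearMap.comp_apply,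
    S.norm_fderiv_apply hd u (S.mapsTo_F_Ω v hx), S.norm_fderiv_apply hd v hx, he, mul_one,
    mul_one] at h
  rw [S.fderiv_F_append hd u v hx, h]

theorem ratio_nil (hd : 0 < d) : S.ratio [] = 1 := by
  have : Nonempty (Fin d) := ⟨⟨0, hd⟩⟩
  have h : S.F [] = id := rfl
  rw [ratio, h, fderiv_id, ContinuousLinearMap.norm_id]

theorem ratio_mul_le (hd : 0 < d) (u v : List I) :
    S.ratio u / S.K * S.ratio v ≤ S.ratio (u ++ v) := by
  rw [ratio, ratio, ratio, S.norm_fderiv_append hd u v S.base_mem_Ω]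
  gcongr
  exact S.le_norm_fderiv u (S.mapsTo_F_Ω v S.base_mem_Ω)

theorem ratio_le_pow (w : List I) : S.ratio w ≤ S.s ^ w.length := by
  have := norm_fderiv_le_of_lipschitzOn ℝ (S.isOpen_Ω.mem_nhds S.base_mem_Ω)
    (S.lipschitzOnWith_F w)
  rwa [Real.coe_toNNReal _ (pow_nonneg S.s_nonneg _)] at this

theorem isOpen_F_image (hd : 0 < d) (w : List I) {U : Set (EuclideanSpace ℝ (Fin d))}
    (hU : IsOpen U) (hUΩ : U ⊆ S.Ω) : IsOpen (S.F w '' U) := by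
  refine isOpen_image_of_injOn_of_injective_fderiv hU ((S.injOn_F w).mono hUΩ)
    (fun x hx => S.differentiableAt_F hd w (hUΩ hx)) fun x hx => ?_
  refine (injective_iff_map_eq_zero _).2 fun v hv => ?_
  have := S.norm_fderiv_apply hd w (hUΩ hx) v
  rw [hv, norm_zero, zero_eq_mul] at this
  exact norm_eq_zero.1 (this.resolve_left (S.norm_fderiv_pos hd w (hUΩ hx)).ne')

theorem interior_X_subset_Ω : interior S.X ⊆ S.Ω := interior_subset.trans S.X_subset_Ω

/-- Openness of `φ_w` is what makes the interior invariant, so that the open set condition passes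
from letters to incomparable words. -/
theorem mapsTo_F_interior (hd : 0 < d) (w : List I) :
    MapsTo (S.F w) (interior S.X) (interior S.X) := by
  rw [mapsTo_iff_image_subset]
  exact interior_maximal ((image_mono interior_subset).trans (S.mapsTo_F_X w).image_subset)
    (S.isOpen_F_image hd w isOpen_interior S.interior_X_subset_Ω)

theorem disjoint_F_interior (hd : 0 < d) {u v : List I} (h : Incomparable u v) :
    Disjoint (S.F u '' interior S.X) (S.F v '' interior S.X) :=
  disjoint_wordMap_image S.interior_X_subset_Ω (fun i => S.mapsTo_F_interior hd [i])
    S.injOn_Ω (fun i j hij => disjoint_iff_inter_eq_empty.2 (S.open_set_condition i j hij)) h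

theorem isCompact_F_X (w : List I) : IsCompact (S.F w '' S.X) :=
  S.isCompact_X.image_of_continuousOn ((S.continuousOn_F w).mono S.X_subset_Ω)

/-- The derivative is a similarity, so its image of the unit ball contains the ball of radius its
norm; this bounds the Jacobian from below by the `d`-th power of the norm. -/
theorem measure_F_image_ge (μ : Measure (EuclideanSpace ℝ (Fin d))) [μ.IsAddHaarMeasure]
    (hd : 0 < d) (w : List I) {B : Set (EuclideanSpace ℝ (Fin d))}
    (hB : MeasurableSet B) (hBΩ : B ⊆ S.Ω) :
    ENNReal.ofReal ((S.ratio w / S.K) ^ d) * μ B ≤ μ (S.F w '' B) := by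
  rw [← lintegral_abs_det_fderiv_eq_addHaar_image μ hB
    (fun x hx => (S.differentiableAt_F hd w (hBΩ hx)).hasFDerivAt.hasFDerivWithinAt)
    ((S.injOn_F w).mono hBΩ), ← setLIntegral_const]
  refine setLIntegral_mono' hB fun x hx => ENNReal.ofReal_le_ofReal ?_
  have hsim := S.norm_fderiv_apply hd w (hBΩ hx)
  have hpos := S.norm_fderiv_pos hd w (hBΩ hx)
  have himg : fderiv ℝ (S.F w) x '' ball 0 1 ⊇ ball 0 ‖fderiv ℝ (S.F w) x‖ := by
    have hinj : Function.Injective (fderiv ℝ (S.F w) x) :=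
      (injective_iff_map_eq_zero _).2 fun v hv => by
        have := hsim v
        rw [hv, norm_zero, zero_eq_mul] at this
        exact norm_eq_zero.1 (this.resolve_left hpos.ne')
    intro y hy
    obtain ⟨v, rfl⟩ := (LinearMap.injective_iff_surjective
      (f := (fderiv ℝ (S.F w) x).toLinearMap)).1 hinj y
    refine ⟨v, ?_, rfl⟩
    have h1 : ‖fderiv ℝ (S.F w) x v‖ < ‖fderiv ℝ (S.F w) x‖ := mem_ball_zero_iff.1 hy
    rw [hsim v] at h1
    rw [mem_ball_zero_iff]
    exact lt_of_mul_lt_mul_left (by rwa [mul_one]) hpos.le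
  have : Nonempty (Fin d) := ⟨⟨0, hd⟩⟩
  have hm := measure_mono (μ := μ) himg
  rw [Measure.addHaar_image_continuousLinearMap, Measure.addHaar_ball _ _ (norm_nonneg _),
    ENNReal.mul_le_mul_iff_left (measure_ball_pos _ _ one_pos).ne' measure_ball_lt_top.ne,
    ENNReal.ofReal_le_ofReal_iff (abs_nonneg _), finrank_euclideanSpace_fin] at hm
  exact (pow_le_pow_left₀ (div_pos (S.ratio_pos hd w) S.K_pos).le
    (S.le_norm_fderiv w (hBΩ hx)) d).trans hm

theorem norm_F_sub_le_of_ball (hd : 0 < d) (w : List I) {x y : EuclideanSpace ℝ (Fin d)} {r : ℝ}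
    (hr : ball x r ⊆ S.Ω) (hy : y ∈ ball x r) :
    ‖S.F w y - S.F w x‖ ≤ S.K * S.ratio w * ‖y - x‖ := by
  have hr0 : 0 < r := dist_nonneg.trans_lt hy
  exact (convex_ball x r).norm_image_sub_le_of_norm_fderiv_le
    (fun z hz => S.differentiableAt_F hd w (hr hz)) (fun z hz => S.norm_fderiv_le w (hr hz))
    (mem_ball_self hr0) hy

/-- The mean value inequality works only on balls in `Ω`, as neither `Ω` nor `X` is convex.
Connectedness of `Ω` chains balls between two points, and compactness of `X` makes the constant
uniform; the chains do not depend on `w`. -/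
theorem exists_norm_F_sub_le (hd : 0 < d) : ∃ D : ℝ, 0 < D ∧ ∀ w, ∀ x ∈ S.X, ∀ y ∈ S.X,
    ‖S.F w x - S.F w y‖ ≤ D * S.ratio w := by
  have hpair : ∀ x ∈ S.Ω, ∃ C : ℝ, ∀ w, ‖S.F w x - S.F w S.base‖ ≤ C * S.ratio w := by
    intro x hx
    refine S.isConnected_Ω.isPreconnected.induction₂'
      (fun x y => ∃ C : ℝ, ∀ w, ‖S.F w x - S.F w y‖ ≤ C * S.ratio w) ?_ ?_ hx S.base_mem_Ω
    · intro x hx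
      obtain ⟨r, hr, hrΩ⟩ := Metric.isOpen_iff.1 S.isOpen_Ω x hx
      filter_upwards [mem_nhdsWithin_of_mem_nhds (ball_mem_nhds x hr)] with y hy
      refine ⟨⟨S.K * ‖y - x‖, fun w => ?_⟩, ⟨S.K * ‖y - x‖, fun w => ?_⟩⟩
      · rw [norm_sub_rev]
        linarith [S.norm_F_sub_le_of_ball hd w hrΩ hy]
      · linarith [S.norm_F_sub_le_of_ball hd w hrΩ hy]
    · rintro x y z _ _ _ ⟨C, hC⟩ ⟨C', hC'⟩
      refine ⟨C + C', fun w => ?_⟩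
      have := norm_sub_le_norm_sub_add_norm_sub (S.F w x) (S.F w y) (S.F w z)
      linarith [hC w, hC' w]
  have hX : ∃ C : ℝ, ∀ x ∈ S.X, ∀ w, ‖S.F w x - S.F w S.base‖ ≤ C * S.ratio w := by
    refine S.isCompact_X.induction_on
      (p := fun A => ∃ C : ℝ, ∀ x ∈ A, ∀ w, ‖S.F w x - S.F w S.base‖ ≤ C * S.ratio w)
      ⟨0, by simp⟩ ?_ ?_ ?_
    · rintro A B hAB ⟨C, hC⟩
      exact ⟨C, fun x hx => hC x (hAB hx)⟩
    · rintro A B ⟨C, hC⟩ ⟨C', hC'⟩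
      refine ⟨max C C', fun x hx w => ?_⟩
      have hw := (S.ratio_pos hd w).le
      rcases hx with hx | hx
      · exact (hC x hx w).trans (by gcongr; exact le_max_left _ _)
      · exact (hC' x hx w).trans (by gcongr; exact le_max_right _ _)
    · intro x hx
      obtain ⟨C, hC⟩ := hpair x (S.X_subset_Ω hx)
      obtain ⟨r, hr, hrΩ⟩ := Metric.isOpen_iff.1 S.isOpen_Ω x (S.X_subset_Ω hx)
      refine ⟨ball x r, mem_nhdsWithin_of_mem_nhds (ball_mem_nhds x hr), S.K * r + C, ?_⟩
      intro y hy w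
      have h1 := S.norm_F_sub_le_of_ball hd w hrΩ hy
      have h2 := norm_sub_le_norm_sub_add_norm_sub (S.F w y) (S.F w x) (S.F w S.base)
      have h3 : S.K * S.ratio w * ‖y - x‖ ≤ S.K * S.ratio w * r := by
        have := (S.ratio_pos hd w).le
        have := S.K_pos.le
        gcongr
        rw [mem_ball, dist_eq_norm] at hy
        exact hy.le
      linarith [hC w]
  obtain ⟨C, hC⟩ := hX
  refine ⟨2 * |C| + 1, by positivity, fun w x hx y hy => ?_⟩
  have h1 := norm_sub_le_norm_sub_add_norm_sub (S.F w x) (S.F w S.base) (S.F w y)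
  rw [norm_sub_rev (S.F w S.base)] at h1
  have hw := S.ratio_pos hd w
  have h2 : C * S.ratio w ≤ |C| * S.ratio w := by gcongr; exact le_abs_self C
  linarith [hC x hx w, hC y hy w]

end CIFS

/-- König's lemma for trees of words. -/
theorem exists_branch_of_finite_levels {I : Type*} {T : Set (List I)}
    (hpre : ∀ u v, u ++ v ∈ T → u ∈ T) (hfin : ∀ n, {w ∈ T | w.length = n}.Finite)
    (hne : ∀ n, ∃ w ∈ T, w.length = n) : ∃ ω : ℕ → I, ∀ n, (List.range n).map ω ∈ T := by
  classical
  -- The words with descendants in the tree at every depth.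
  let P : List I → Prop := fun w => ∀ n, ∃ v : List I, v.length = n ∧ w ++ v ∈ T
  have hstep : ∀ w, P w → ∃ i, P (w ++ [i]) := by
    intro w hw
    by_contra! hno
    simp only [P, not_forall, not_exists, not_and] at hno
    choose m hm using hno
    have hF : {i : I | w ++ [i] ∈ T}.Finite := by
      refine ((hfin (w.length + 1)).preimage (f := fun i => w ++ [i]) ?_).subset ?_
      · intro i _ j _ hij
        simpa using hij
      · intro i hi
        exact ⟨hi, by simp⟩
    -- Each child `i` has a depth `m i` at which its descendants are missing. Finitely many children
    -- lie in the tree, so a descendant of `w` at depth `M + 1` passes through a child that survives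
    -- to depth `M ≥ m i`.
    obtain ⟨M, hM⟩ := (hF.image m).bddAbove
    obtain ⟨v, hv, hvT⟩ := hw (M + 1)
    obtain ⟨i, v', rfl⟩ : ∃ i v', v = i :: v' := by
      cases v with
      | nil => simp at hv
      | cons i v' => exact ⟨i, v', rfl⟩
    have hvT' : (w ++ [i]) ++ v' ∈ T := by simpa using hvT
    have hi : m i ≤ M := hM ⟨i, hpre _ _ hvT', rfl⟩
    have hlen : v'.length = M := by simpa using hv
    refine hm i (v'.take (m i)) (by simp [hlen, hi]) ?_
    refine hpre _ (v'.drop (m i)) ?_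
    rw [List.append_assoc, List.take_append_drop]
    exact hvT'
  have : Nonempty I := by
    obtain ⟨w, -, hw⟩ := hne 1
    exact ⟨w.head (by rintro rfl; simp at hw)⟩
  choose! g hg using hstep
  let W : ℕ → List I := fun n => Nat.rec [] (fun _ w => w ++ [g w]) n
  have hW : ∀ n, P (W n) := by
    intro n
    induction n with
    | zero =>
      intro n
      obtain ⟨w, hw, hl⟩ := hne n
      exact ⟨w, hl, hw⟩
    | succ n ih => exact hg _ ih
  refine ⟨fun n => g (W n), fun n => ?_⟩
  have : (List.range n).map (fun n => g (W n)) = W n := by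
    induction n with
    | zero => rfl
    | succ n ih => rw [List.range_succ, List.map_append, ih]; rfl
  rw [this]
  obtain ⟨v, _, hv⟩ := hW n 0
  exact hpre _ _ hv

/-! ### The limit set: self-similarity, multiplicity, measurability -/

namespace CIFS

open Metric Module

variable {d : ℕ} {I : Type*} (S : CIFS d I)

theorem mem_limitSet_iff {x : EuclideanSpace ℝ (Fin d)} :
    x ∈ S.limitSet ↔ ∃ ω : ℕ → I, ∀ n, x ∈ S.F ((List.range n).map ω) '' S.X := by
  simp only [limitSet, mem_iUnion, mem_iInter]
  refine exists_congr fun ω => ⟨fun h n => ?_, fun h n => h _⟩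
  cases n with
  | zero => exact ⟨x, (S.mapsTo_F_X _).image_subset (h 0), rfl⟩
  | succ n => exact h n

theorem limitSet_subset_X : S.limitSet ⊆ S.X := by
  intro x hx
  obtain ⟨ω, hω⟩ := S.mem_limitSet_iff.1 hx
  exact (S.mapsTo_F_X _).image_subset (hω 0)

theorem limitSet_subset_Ω : S.limitSet ⊆ S.Ω := S.limitSet_subset_X.trans S.X_subset_Ω

theorem mapsTo_φ_limitSet (i : I) : MapsTo (S.φ i) S.limitSet S.limitSet := by
  intro x hx
  obtain ⟨ω, hω⟩ := S.mem_limitSet_iff.1 hx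
  refine S.mem_limitSet_iff.2 ⟨fun n => Nat.casesOn n i ω, fun n => ?_⟩
  cases n with
  | zero => exact ⟨_, S.mapsTo_X i (S.limitSet_subset_X hx), rfl⟩
  | succ n =>
    rw [List.range_succ_eq_map, List.map_cons, List.map_map]
    obtain ⟨y, hy, hyx⟩ := hω n
    exact ⟨y, hy, congrArg (S.φ i) hyx⟩

theorem mapsTo_F_limitSet (w : List I) : MapsTo (S.F w) S.limitSet S.limitSet :=
  mapsTo_wordMap S.mapsTo_φ_limitSet w

theorem limitSet_subset_iUnion_φ : S.limitSet ⊆ ⋃ i, S.φ i '' S.limitSet := by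
  intro x hx
  obtain ⟨ω, hω⟩ := S.mem_limitSet_iff.1 hx
  obtain ⟨y, hy, rfl⟩ := hω 1
  refine mem_iUnion.2 ⟨ω 0, y, S.mem_limitSet_iff.2 ⟨fun n => ω (n + 1), fun n => ?_⟩, rfl⟩
  have h := hω (n + 1)
  rw [List.range_succ_eq_map, List.map_cons, List.map_map] at h
  obtain ⟨z, hz, hzy⟩ := h
  exact ⟨z, hz, S.injOn_Ω (ω 0) (S.mapsTo_F_Ω _ (S.X_subset_Ω hz)) (S.X_subset_Ω hy) hzy⟩

theorem exists_word_of_mem_limitSet (n : ℕ) {x : EuclideanSpace ℝ (Fin d)}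
    (hx : x ∈ S.limitSet) : ∃ w : List I, w.length = n ∧ x ∈ S.F w '' S.limitSet := by
  induction n generalizing x with
  | zero => exact ⟨[], rfl, x, hx, rfl⟩
  | succ n ih =>
    obtain ⟨i, y, hy, rfl⟩ := mem_iUnion.1 (S.limitSet_subset_iUnion_φ hx)
    obtain ⟨w, hw, z, hz, rfl⟩ := ih hy
    exact ⟨i :: w, by simp [hw], z, hz, rfl⟩

theorem measurableSet_F_image (hd : 0 < d) (w : List I) {B : Set (EuclideanSpace ℝ (Fin d))}
    (hB : MeasurableSet B) (hBΩ : B ⊆ S.Ω) : MeasurableSet (S.F w '' B) :=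
  measurable_image_of_fderivWithin hB
    (fun _ hx => (S.differentiableAt_F hd w (hBΩ hx)).hasFDerivAt.hasFDerivWithinAt)
    ((S.injOn_F w).mono hBΩ)

/-- Interior points have density one at small scales and boundary points are covered by the density
condition. The constant is uniform, the scale `R` is not. -/
theorem exists_density : ∃ c : ℝ≥0∞, 0 < c ∧ ∀ y ∈ S.X, ∃ R : ℝ, 0 < R ∧ ∀ r, 0 < r → r < R →
    c * μH[(d : ℝ)] (closedBall y r) ≤ μH[(d : ℝ)] (closedBall y r ∩ interior S.X) := by
  obtain ⟨r₀, hr₀, hpos⟩ := S.boundary_density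
  refine ⟨min 1 _, lt_min one_pos hpos, fun y hy => ?_⟩
  by_cases hyi : y ∈ interior S.X
  · obtain ⟨R, hR, hRX⟩ := Metric.isOpen_iff.1 isOpen_interior y hyi
    refine ⟨R, hR, fun r _ hr => ?_⟩
    rw [inter_eq_left.2 ((closedBall_subset_ball hr).trans hRX)]
    exact mul_le_of_le_one_left (zero_le) (min_le_left _ _)
  · have hyf : y ∈ frontier S.X := by
      rw [S.isCompact_X.isClosed.frontier_eq]
      exact ⟨hy, hyi⟩
    refine ⟨r₀, hr₀, fun r hr hrr => ?_⟩
    rw [← ENNReal.le_div_iff_mul_le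
      (Or.inl (measure_closedBall_pos _ y hr).ne') (Or.inl measure_closedBall_lt_top.ne)]
    exact (min_le_right _ _).trans ((iInf₂_le y hyf).trans (iInf₂_le r ⟨hr, hrr⟩))

/-- A volume count at one tiny scale around `x`: each cylinder through `x` contributes an image of a
piece of the interior of `X`, the pieces are disjoint, and each fills a fixed fraction of the ball.
The ratios of the words need not be comparable, since the scale may depend on the finite family. -/
theorem exists_multiplicity_bound (hd : 0 < d) : ∃ N : ℕ, ∀ (x : EuclideanSpace ℝ (Fin d))
    (T : Finset (List I)), (T : Set (List I)).Pairwise Incomparable →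
    (∀ u ∈ T, x ∈ S.F u '' S.X) → T.card ≤ N := by
  have : Nonempty (Fin d) := ⟨⟨0, hd⟩⟩
  obtain ⟨c, hc, hdens⟩ := S.exists_density
  set q : ℝ≥0∞ := c * ENNReal.ofReal ((S.K ^ 2)⁻¹ ^ d) with hq
  have hK := S.K_pos
  have hq0 : q ≠ 0 := mul_ne_zero hc.ne' (by simpa using by positivity)
  obtain ⟨N, hN⟩ := ENNReal.exists_nat_gt (ENNReal.inv_ne_top.2 hq0)
  refine ⟨N, fun x T hT hx => ?_⟩
  choose! y hyX hyx using hx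
  choose! R hR hRd using hdens
  have hball : ∀ z ∈ S.X, ∃ r, 0 < r ∧ ball z r ⊆ S.Ω :=
    fun z hz => Metric.isOpen_iff.1 S.isOpen_Ω z (S.X_subset_Ω hz)
  choose! R' hR' hRΩ using hball
  -- The radius in `X` whose image under `φ_u` is certain to stay within `τ` of `x`.
  set δ : List I → ℝ → ℝ := fun u τ => τ / (S.K * S.ratio u)
  have hδpos : ∀ u τ, 0 < τ → 0 < δ u τ := fun u τ hτ =>
    div_pos hτ (mul_pos hK (S.ratio_pos hd u))
  obtain ⟨τ, hτ, hτ0⟩ : ∃ τ : ℝ, (∀ u ∈ T, δ u τ < min (R (y u)) (R' (y u))) ∧ 0 < τ := by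
    have h1 : ∀ u ∈ T, ∀ᶠ τ in 𝓝[>] (0 : ℝ), δ u τ < min (R (y u)) (R' (y u)) := by
      intro u hu
      have : Tendsto (δ u) (𝓝 0) (𝓝 (δ u 0)) := (continuous_id.div_const _).tendsto 0
      simp only [δ, zero_div] at this
      exact (this.mono_left nhdsWithin_le_nhds).eventually_lt_const
        (lt_min (hR _ (hyX u hu)) (hR' _ (hyX u hu)))
    exact (((Finset.eventually_all T).2 h1).and self_mem_nhdsWithin).exists
  set μ := (μH[(d : ℝ)] : Measure (EuclideanSpace ℝ (Fin d))) with hμ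
  let B : List I → Set (EuclideanSpace ℝ (Fin d)) :=
    fun u => closedBall (y u) (δ u τ) ∩ interior S.X
  have hBm : ∀ u, MeasurableSet (B u) :=
    fun u => measurableSet_closedBall.inter isOpen_interior.measurableSet
  have hBΩ : ∀ u, B u ⊆ S.Ω := fun u => inter_subset_right.trans S.interior_X_subset_Ω
  have hsub : ∀ u ∈ T, S.F u '' B u ⊆ closedBall x τ := by
    rintro u hu _ ⟨z, hz, rfl⟩
    have hzb : ‖z - y u‖ ≤ δ u τ := by rw [← dist_eq_norm]; exact hz.1
    have h1 := S.norm_F_sub_le_of_ball hd u (hRΩ _ (hyX u hu)) (y := z)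
      (by rw [mem_ball, dist_eq_norm]
          exact hzb.trans_lt ((hτ u hu).trans_le (min_le_right _ _)))
    rw [hyx u hu] at h1
    rw [mem_closedBall, dist_eq_norm]
    refine h1.trans ?_
    have hp := mul_pos hK (S.ratio_pos hd u)
    calc S.K * S.ratio u * ‖z - y u‖ ≤ S.K * S.ratio u * δ u τ := by gcongr
      _ = τ := mul_div_cancel₀ _ hp.ne'
  have hvol : ∀ u ∈ T, q * μ (closedBall x τ) ≤ μ (S.F u '' B u) := by
    intro u hu
    refine le_trans ?_ (S.measure_F_image_ge μ hd u (hBm u) (hBΩ u))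
    refine le_trans ?_ (mul_le_mul_right (hRd (y u) (hyX u hu) (δ u τ) (hδpos u τ hτ0)
      ((hτ u hu).trans_le (min_le_left _ _))) _)
    rw [Measure.addHaar_closedBall μ _ hτ0.le, Measure.addHaar_closedBall _ _ (hδpos u τ hτ0).le,
      finrank_euclideanSpace_fin, hq]
    have hr := S.ratio_pos hd u
    have e : (S.K ^ 2)⁻¹ ^ d * τ ^ d = (S.ratio u / S.K) ^ d * (δ u τ) ^ d := by
      rw [← mul_pow, ← mul_pow]
      congr 1
      simp only [δ]
      field_simp
    rw [mul_assoc c, ← mul_assoc (ENNReal.ofReal _), ← ENNReal.ofReal_mul (by positivity), e,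
      ENNReal.ofReal_mul (by positivity)]
    exact le_of_eq (by ring)
  have hsum : T.card * (q * μ (closedBall x τ)) ≤ μ (closedBall x τ) := by
    calc T.card * (q * μ (closedBall x τ)) = ∑ _u ∈ T, q * μ (closedBall x τ) := by
          rw [Finset.sum_const, nsmul_eq_mul]
      _ ≤ ∑ u ∈ T, μ (S.F u '' B u) := Finset.sum_le_sum hvol
      _ = μ (⋃ u ∈ T, S.F u '' B u) := by
          refine (measure_biUnion_finset (fun u hu v hv huv => ?_) fun u _ =>
            S.measurableSet_F_image hd u (hBm u) (hBΩ u)).symm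
          exact (S.disjoint_F_interior hd (hT hu hv huv)).mono
            (image_mono inter_subset_right) (image_mono inter_subset_right)
      _ ≤ _ := measure_mono (iUnion₂_subset hsub)
  rw [← mul_assoc] at hsum
  have h1 : T.card * q ≤ 1 := by
    have h2 : T.card * q * μ (closedBall x τ) ≤ 1 * μ (closedBall x τ) := by rwa [one_mul]
    exact (ENNReal.mul_le_mul_iff_left (measure_closedBall_pos μ x hτ0).ne'
      measure_closedBall_lt_top.ne).1 h2
  have h3 : (T.card : ℝ≥0∞) ≤ q⁻¹ := by
    rw [ENNReal.le_inv_iff_mul_le]; exact h1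
  exact_mod_cast (h3.trans hN.le)

/-- A point covered at every level lies on an infinite branch: by the multiplicity bound its tree of
cylinders has finite levels even for infinite `I`, so König's lemma applies. This exhibits the limit
set as Borel when `I` is countable. -/
theorem limitSet_eq_iInter (hd : 0 < d) :
    S.limitSet = ⋂ n : ℕ, ⋃ w ∈ {w : List I | w.length = n}, S.F w '' S.X := by
  refine Subset.antisymm (fun x hx => mem_iInter.2 fun n => ?_) fun x hx => ?_
  · obtain ⟨w, hw, hxw⟩ := S.exists_word_of_mem_limitSet n hx
    exact mem_iUnion₂.2 ⟨w, hw, image_mono S.limitSet_subset_X hxw⟩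
  · rw [S.mem_limitSet_iff]
    refine exists_branch_of_finite_levels (T := {w | x ∈ S.F w '' S.X}) ?_ ?_ ?_
    · rintro u v ⟨y, hy, hyx⟩
      exact ⟨S.F v y, S.mapsTo_F_X v hy, by rw [← hyx, F_append]⟩
    · intro n
      obtain ⟨N, hN⟩ := S.exists_multiplicity_bound hd
      by_contra hinf
      obtain ⟨T, hTs, hTc⟩ := Set.Infinite.exists_subset_card_eq hinf (N + 1)
      have := hN x T (fun u hu v hv huv => incomparable_of_length_eq
        ((hTs hu).2.trans (hTs hv).2.symm) huv) fun u hu => (hTs hu).1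
      omega
    · intro n
      obtain ⟨w, hw, hxw⟩ := mem_iUnion₂.1 (mem_iInter.1 hx n)
      exact ⟨w, hxw, hw⟩

theorem measurableSet_limitSet [Countable I] (hd : 0 < d) : MeasurableSet S.limitSet := by
  rw [S.limitSet_eq_iInter hd]
  exact MeasurableSet.iInter fun n => MeasurableSet.biUnion (to_countable _) fun w _ =>
    (S.isCompact_F_X w).measurableSet

end CIFS

/-- Mass distribution principle. -/
theorem hausdorffMeasure_ne_zero_of_measure_preimage_closedBall_le {α Y : Type*}
    [MeasurableSpace α] [MetricSpace Y] [MeasurableSpace Y] [BorelSpace Y] (P : Measure α)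
    (hP : P univ ≠ 0) (π : α → Y) {C : ℝ≥0∞} (hC0 : C ≠ 0) (hC : C ≠ ∞) {s : ℝ} (hs : 0 < s)
    (h : ∀ x r, 0 < r → r < 1 → P (π ⁻¹' Metric.closedBall x r) ≤ C * ENNReal.ofReal (r ^ s))
    {A : Set Y} (hA : ∀ ω, π ω ∈ A) : μH[s] A ≠ 0 := by
  intro hA0
  have hset : ∀ B : Set Y, Metric.ediam B ≤ ENNReal.ofReal (1 / 2) →
      C⁻¹ * P (π ⁻¹' B) ≤ Metric.ediam B ^ s := by
    intro B hB
    rcases B.eq_empty_or_nonempty with rfl | ⟨x, hx⟩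
    · simp
    have hfin : Metric.ediam B ≠ ∞ := ne_top_of_le_ne_top ENNReal.ofReal_ne_top hB
    set δ := (Metric.ediam B).toReal with hδ
    have hδe : Metric.ediam B = ENNReal.ofReal δ := (ENNReal.ofReal_toReal hfin).symm
    have hδ0 : 0 ≤ δ := ENNReal.toReal_nonneg
    have hδ1 : δ ≤ 1 / 2 := by
      rw [hδe] at hB
      exact (ENNReal.ofReal_le_ofReal_iff (by norm_num)).1 hB
    have hBr : ∀ r, δ < r → B ⊆ Metric.closedBall x r := by
      intro r hr y hy
      have := Metric.edist_le_ediam_of_mem hy hx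
      rw [hδe, edist_dist, ENNReal.ofReal_le_ofReal_iff hδ0] at this
      exact this.trans hr.le
    -- The diameter `δ` may be zero, so balls of radius `r > δ` are used and `r` decreases to `δ`.
    have hlim : Tendsto (fun r : ℝ => C * ENNReal.ofReal (r ^ s)) (𝓝[>] δ)
        (𝓝 (C * ENNReal.ofReal (δ ^ s))) := by
      refine ENNReal.Tendsto.const_mul ?_ (Or.inr hC)
      exact (ENNReal.continuous_ofReal.tendsto _).comp
        ((Real.continuousAt_rpow_const _ _ (Or.inr hs.le)).mono_left nhdsWithin_le_nhds)
    have hle : P (π ⁻¹' B) ≤ C * ENNReal.ofReal (δ ^ s) := by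
      refine ge_of_tendsto hlim ?_
      filter_upwards [Ioo_mem_nhdsGT (show δ < 1 by linarith)] with r hr
      exact (measure_mono (preimage_mono (hBr r hr.1))).trans
        (h x r (hδ0.trans_lt hr.1) hr.2)
    rw [hδe, ENNReal.ofReal_rpow_of_nonneg hδ0 hs.le]
    calc C⁻¹ * P (π ⁻¹' B) ≤ C⁻¹ * (C * ENNReal.ofReal (δ ^ s)) := by gcongr
      _ = _ := by rw [← mul_assoc, ENNReal.inv_mul_cancel hC0 hC, one_mul]
  -- The push-forward is taken as an outer measure, so `π` need not be measurable.
  have hle := OuterMeasure.le_mkMetric (X := Y) (fun r => r ^ s)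
    (OuterMeasure.map π (C⁻¹ • P).toOuterMeasure) (ENNReal.ofReal (1 / 2)) (by simp)
    (fun B hB => by simpa [OuterMeasure.map_apply] using hset B hB) A
  rw [← Measure.mkMetric_toOuterMeasure] at hle
  have h1 : C⁻¹ * P univ ≤ 0 := by
    rw [← hA0]
    have hu : π ⁻¹' A = univ := eq_univ_of_forall hA
    change (C⁻¹ • P) (π ⁻¹' A) ≤ μH[s] A at hle
    rwa [hu] at hle
  rcases mul_eq_zero.1 (le_antisymm h1 (zero_le)) with h2 | h2
  exacts [ENNReal.inv_ne_zero.2 hC h2, hP h2]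

/-! ### Level sums at the dimension and finiteness of `ℋ^t(E)` -/

namespace CIFS

open Metric Module

variable {d : ℕ} {I : Type*} (S : CIFS d I)

theorem exists_mem_of_words (hd : 0 < d) {u : ℕ → List I} (hu : ∀ k, u k <+: u (k + 1))
    (hlen : ∀ k, k ≤ (u k).length) : ∃ x ∈ S.limitSet, ∀ k, x ∈ S.F (u k) '' S.X := by
  obtain ⟨x, hx⟩ := IsCompact.nonempty_iInter_of_sequence_nonempty_isCompact_isClosed
    (fun k => S.F (u k) '' S.X) (fun k => by
      obtain ⟨v, hv⟩ := hu k
      rintro _ ⟨y, hy, rfl⟩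
      exact ⟨S.F v y, S.mapsTo_F_X v hy, by rw [← F_append, hv]⟩)
    (fun k => ⟨_, S.base, S.base_mem_X, rfl⟩) (S.isCompact_F_X _)
    (fun k => (S.isCompact_F_X _).isClosed)
  rw [mem_iInter] at hx
  refine ⟨x, ?_, hx⟩
  rw [S.limitSet_eq_iInter hd, mem_iInter]
  intro n
  obtain ⟨y, hy, hyx⟩ := hx n
  refine mem_iUnion₂.2 ⟨(u n).take n, by simp [hlen n], S.F ((u n).drop n) y,
    S.mapsTo_F_X _ hy, ?_⟩
  rw [← F_append, List.take_append_drop, hyx]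

/-- Only boundedly many of the sets `φ_w(X)`, for incomparable words `w` of contraction ratio
comparable to `r`, meet a given ball of radius `r`. -/
theorem exists_card_bound (hd : 0 < d) {c : ℝ} (hc : 0 < c) : ∃ N : ℕ,
    ∀ (x : EuclideanSpace ℝ (Fin d)) (r : ℝ), 0 < r → ∀ T : Finset (List I),
    (T : Set (List I)).Pairwise Incomparable → (∀ u ∈ T, c * r ≤ S.ratio u ∧ S.ratio u ≤ r) →
    (∀ u ∈ T, (S.F u '' S.X ∩ closedBall x r).Nonempty) → T.card ≤ N := by
  have : Nonempty (Fin d) := ⟨⟨0, hd⟩⟩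
  obtain ⟨D, hD, hdiam⟩ := S.exists_norm_F_sub_le hd
  have hK := S.K_pos
  set μ := (volume : Measure (EuclideanSpace ℝ (Fin d)))
  set q : ℝ≥0∞ := ENNReal.ofReal ((c / S.K) ^ d) * μ (interior S.X)
  have hq0 : q ≠ 0 := mul_ne_zero (by simpa using by positivity)
    (isOpen_interior.measure_pos μ S.nonempty_interior_X).ne'
  set b : ℝ≥0∞ := ENNReal.ofReal ((1 + D) ^ d) * μ (ball 0 1)
  have hb : b ≠ ∞ := ENNReal.mul_ne_top ENNReal.ofReal_ne_top measure_ball_lt_top.ne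
  obtain ⟨N, hN⟩ := ENNReal.exists_nat_gt (ENNReal.div_ne_top hb hq0)
  refine ⟨N, fun x r hr T hT hρ hx => ?_⟩
  have hsub : ∀ u ∈ T, S.F u '' interior S.X ⊆ closedBall x (r * (1 + D)) := by
    rintro u hu _ ⟨z, hz, rfl⟩
    obtain ⟨_, ⟨y, hy, rfl⟩, hyb⟩ := hx u hu
    rw [mem_closedBall, dist_eq_norm] at hyb ⊢
    have h1 := hdiam u z (interior_subset hz) y hy
    have h2 := norm_sub_le_norm_sub_add_norm_sub (S.F u z) (S.F u y) x
    have h3 : D * S.ratio u ≤ D * r := by gcongr; exact (hρ u hu).2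
    linarith
  have hvol : ∀ u ∈ T, ENNReal.ofReal (r ^ d) * q ≤ μ (S.F u '' interior S.X) := by
    intro u hu
    refine le_trans ?_ (S.measure_F_image_ge μ hd u isOpen_interior.measurableSet
      S.interior_X_subset_Ω)
    rw [← mul_assoc, ← ENNReal.ofReal_mul (by positivity), ← mul_pow]
    gcongr
    calc r * (c / S.K) = c * r / S.K := by ring
      _ ≤ S.ratio u / S.K := by gcongr; exact (hρ u hu).1
  have hr0 : ENNReal.ofReal (r ^ d) ≠ 0 := by simpa using by positivity
  have hsum : ENNReal.ofReal (r ^ d) * (T.card * q) ≤ ENNReal.ofReal (r ^ d) * b := by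
    calc ENNReal.ofReal (r ^ d) * (T.card * q) = ∑ _u ∈ T, ENNReal.ofReal (r ^ d) * q := by
          rw [Finset.sum_const, nsmul_eq_mul]; ring
      _ ≤ ∑ u ∈ T, μ (S.F u '' interior S.X) := Finset.sum_le_sum hvol
      _ = μ (⋃ u ∈ T, S.F u '' interior S.X) :=
          (measure_biUnion_finset (fun u hu v hv huv => S.disjoint_F_interior hd (hT hu hv huv))
            fun u _ => (S.isOpen_F_image hd u isOpen_interior
              S.interior_X_subset_Ω).measurableSet).symm
      _ ≤ μ (closedBall x (r * (1 + D))) := measure_mono (iUnion₂_subset hsub)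
      _ = _ := by
          rw [Measure.addHaar_closedBall μ _ (by positivity), finrank_euclideanSpace_fin,
            mul_pow, ENNReal.ofReal_mul (by positivity), mul_assoc]
  have h1 := (ENNReal.mul_le_mul_iff_right hr0 ENNReal.ofReal_ne_top).1 hsum
  have h2 : (T.card : ℝ≥0∞) ≤ b / q :=
    (ENNReal.le_div_iff_mul_le (Or.inl hq0) (Or.inr hb)).2 h1
  exact_mod_cast h2.trans hN.le

/-- If the weights `(ρ_w / K) ^ s` of finitely many words of the same length add up to at least
one, then the `s`-dimensional Hausdorff measure of the limit set is positive. -/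
theorem hausdorffMeasure_limitSet_ne_zero (hd : 0 < d) {n : ℕ} (hn : n ≠ 0) {s : ℝ} (hs : 0 < s)
    (W : Finset (List I)) (hW : ∀ w ∈ W, w.length = n)
    (h1 : 1 ≤ ∑ w ∈ W, (S.ratio w / S.K) ^ s) : μH[s] S.limitSet ≠ 0 := by
  classical
  have hK := S.K_pos
  set q : W → ℝ := fun j => (S.ratio j / S.K) ^ s with hq
  have hq0 : ∀ j, 0 < q j := fun j => Real.rpow_pos_of_pos (div_pos (S.ratio_pos hd _) hK) s
  set Q : ℝ := ∑ j, q j with hQ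
  have hQ1 : 1 ≤ Q := by
    rw [hQ, hq]
    rwa [← Finset.sum_coe_sort] at h1
  have hQ0 : 0 < Q := one_pos.trans_le hQ1
  let _ : MeasurableSpace W := ⊤
  have : DiscreteMeasurableSpace W := ⟨fun _ => trivial⟩
  -- The weights are divided by `Q ≥ 1`, so the probability of each word is still at most its weight
  -- `q j`.
  set ν : Measure W := ∑ j, ENNReal.ofReal (q j / Q) • Measure.dirac j with hν
  have hνp : IsProbabilityMeasure ν := by
    refine ⟨?_⟩
    rw [hν]
    simp only [Measure.coe_finsetSum, Finset.sum_apply, Measure.smul_apply, smul_eq_mul,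
      measure_univ, mul_one]
    rw [← ENNReal.ofReal_sum_of_nonneg (fun j _ => (div_pos (hq0 j) hQ0).le), ← Finset.sum_div,
      div_self hQ0.ne', ENNReal.ofReal_one]
  have hνj : ∀ j, ν {j} ≤ ENNReal.ofReal (q j) := by
    intro j
    rw [hν]
    simp only [Measure.coe_finsetSum, Finset.sum_apply, Measure.smul_apply, smul_eq_mul]
    rw [Finset.sum_eq_single j]
    · rw [Measure.dirac_apply_of_mem (mem_singleton j), mul_one]
      exact ENNReal.ofReal_le_ofReal (div_le_self (hq0 j).le hQ1)
    · intro b _ hb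
      simp [hb]
    · simp
  set P := Measure.infinitePi (fun _ : ℕ => ν) with hP
  let pre : (ℕ → W) → ℕ → List W := fun ω k => (List.range k).map ω
  let g : List W → List I := fun l => (l.map Subtype.val).flatten
  have hpre_succ : ∀ ω k, pre ω (k + 1) = pre ω k ++ [ω k] := by
    intro ω k
    simp [pre, List.range_succ]
  have hg_succ : ∀ ω k, g (pre ω (k + 1)) = g (pre ω k) ++ (ω k : List I) := by
    intro ω k
    simp [g, hpre_succ]
  have hpre_len : ∀ ω k, (pre ω k).length = k := by simp [pre]
  have hg_len : ∀ ω k, k ≤ (g (pre ω k)).length := by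
    intro ω k
    induction k with
    | zero => simp
    | succ k ih =>
      rw [hg_succ, List.length_append, hW _ (ω k).2]
      omega
  -- comparison of the weights with the contraction ratios
  have hprod : ∀ ω k, ∏ i ∈ Finset.range k, q (ω i) ≤ S.ratio (g (pre ω k)) ^ s := by
    intro ω k
    induction k with
    | zero => simp [pre, g, S.ratio_nil hd]
    | succ k ih =>
      rw [Finset.prod_range_succ, hg_succ]
      have hr := S.ratio_pos hd (g (pre ω k))
      have hr' := S.ratio_pos hd (ω k : List I)
      calc (∏ i ∈ Finset.range k, q (ω i)) * q (ω k)
          ≤ S.ratio (g (pre ω k)) ^ s * q (ω k) := mul_le_mul_of_nonneg_right ih (hq0 _).le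
        _ = (S.ratio (g (pre ω k)) / S.K * S.ratio (ω k : List I)) ^ s := by
            rw [hq, ← Real.mul_rpow hr.le (by positivity)]
            congr 1
            ring
        _ ≤ _ := Real.rpow_le_rpow (by positivity) (S.ratio_mul_le hd _ _) hs.le
  have hcyl : ∀ ω k, P {ω' | pre ω' k = pre ω k} ≤
      ENNReal.ofReal (S.ratio (g (pre ω k)) ^ s) := by
    intro ω k
    have hsub : {ω' | pre ω' k = pre ω k} ⊆
        Set.pi (Finset.range k : Set ℕ) (fun i => {ω i}) := by
      intro ω' hω' i hi
      have hi' : i < k := by simpa using hi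
      have : ω' i = ω i := List.map_inj_left.1 hω' i (List.mem_range.2 hi')
      exact this
    calc P {ω' | pre ω' k = pre ω k} ≤ _ := measure_mono hsub
      _ = ∏ i ∈ Finset.range k, ν {ω i} :=
          Measure.infinitePi_pi (fun _ : ℕ => ν) fun _ _ => MeasurableSet.singleton _
      _ ≤ ∏ i ∈ Finset.range k, ENNReal.ofReal (q (ω i)) := Finset.prod_le_prod' fun i _ => hνj _
      _ = ENNReal.ofReal (∏ i ∈ Finset.range k, q (ω i)) :=
          (ENNReal.ofReal_prod_of_nonneg fun i _ => (hq0 _).le).symm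
      _ ≤ _ := ENNReal.ofReal_le_ofReal (hprod ω k)
  -- the coding map
  have hcode : ∀ ω : ℕ → W, ∃ x ∈ S.limitSet, ∀ k, x ∈ S.F (g (pre ω k)) '' S.X := fun ω =>
    S.exists_mem_of_words hd (u := fun k => g (pre ω k))
      (fun k => by rw [hg_succ]; exact List.prefix_append _ _) (hg_len ω)
  choose π hπE hπ using hcode
  have hWne : (Finset.univ : Finset W).Nonempty := by
    rw [Finset.nonempty_iff_ne_empty]
    intro h0
    rw [hQ, h0, Finset.sum_empty] at hQ1
    exact absurd hQ1 (by norm_num)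
  -- Finiteness of `W` bounds the loss of ratio in one step: stopping when the ratio first drops to
  -- `r` leaves it at least `c r`.
  obtain ⟨j₀, -, hj₀⟩ := Finset.exists_min_image Finset.univ (fun j : W => S.ratio j) hWne
  set c : ℝ := S.ratio (j₀ : List I) / S.K with hc
  have hc0 : 0 < c := div_pos (S.ratio_pos hd _) hK
  obtain ⟨N, hN⟩ := S.exists_card_bound hd hc0
  -- The added one only ensures a nonzero constant.
  refine hausdorffMeasure_ne_zero_of_measure_preimage_closedBall_le P (by simp) π
    (C := (N : ℝ≥0∞) + 1) (by simp) (by simp) hs ?_ hπE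
  intro x r hr hr1
  -- stopping at scale `r`
  have hreach : ∀ ω, ∃ k, S.ratio (g (pre ω k)) ≤ r := by
    intro ω
    obtain ⟨k, hk⟩ := exists_pow_lt_of_lt_one hr S.s_lt_one
    exact ⟨k, (S.ratio_le_pow _).trans ((pow_le_pow_of_le_one S.s_nonneg S.s_lt_one.le
      (hg_len ω k)).trans hk.le)⟩
  let κ : (ℕ → W) → ℕ := fun ω => Nat.find (hreach ω)
  have hκ : ∀ ω, S.ratio (g (pre ω (κ ω))) ≤ r := fun ω => Nat.find_spec (hreach ω)
  have hκ' : ∀ ω, c * r ≤ S.ratio (g (pre ω (κ ω))) := by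
    intro ω
    -- Stopping cannot occur at time zero, since the empty word has ratio `1 > r`.
    obtain ⟨k, hk⟩ : ∃ k, κ ω = k + 1 := by
      refine Nat.exists_eq_succ_of_ne_zero fun h0 => ?_
      have := hκ ω
      rw [h0] at this
      simp only [pre, g, List.range_zero, List.map_nil, List.flatten_nil, S.ratio_nil hd] at this
      linarith
    have hlt : r < S.ratio (g (pre ω k)) := not_le.1 (Nat.find_min (hreach ω) (by
      change k < κ ω; omega))
    rw [hk, hg_succ]
    refine le_trans ?_ (S.ratio_mul_le hd _ _)
    calc c * r = r / S.K * S.ratio (j₀ : List I) := by rw [hc]; ring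
      _ ≤ _ := by
        have := (S.ratio_pos hd (j₀ : List I)).le
        have := (S.ratio_pos hd (g (pre ω k))).le
        gcongr
        exact hj₀ _ (Finset.mem_univ _)
  set A : Set (List W) := {l | (∃ ω, pre ω (κ ω) = l) ∧
    (S.F (g l) '' S.X ∩ closedBall x r).Nonempty} with hA
  -- Stopped sequences form an antichain because the stopping time depends only on the prefix read
  -- so far. Flattening reflects prefixes because all blocks have the same length `n > 0`.
  have hinc : A.Pairwise fun l l' => Incomparable (g l) (g l') := by
    have key : ∀ ω ω', pre ω (κ ω) <+: pre ω' (κ ω') → pre ω (κ ω) = pre ω' (κ ω') := by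
      intro ω ω' hpp
      have hle : κ ω ≤ κ ω' := by simpa [hpre_len] using hpp.length_le
      have heq : pre ω (κ ω) = pre ω' (κ ω) := by
        have := List.prefix_iff_eq_take.1 hpp
        rw [this, hpre_len]
        simp only [pre, ← List.map_take, List.take_range, min_eq_left hle]
      have hge : κ ω' ≤ κ ω := Nat.find_min' (hreach ω') (by rw [← heq]; exact hκ ω)
      exact hpp.eq_of_length (by rw [hpre_len, hpre_len]; omega)
    have hgpre : ∀ l l' : List W, g l <+: g l' → l <+: l' := by
      intro l
      induction l with
      | nil => exact fun _ _ => List.nil_prefix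
      | cons a l ih =>
        intro l' hll
        cases l' with
        | nil =>
          have := hll.length_le
          simp only [g, List.map_cons, List.flatten_cons, List.length_append, hW _ a.2,
            List.map_nil, List.flatten_nil, List.length_nil] at this
          omega
        | cons b l' =>
          obtain ⟨v, hv⟩ := hll
          simp only [g, List.map_cons, List.flatten_cons, List.append_assoc] at hv
          obtain ⟨e1, e2⟩ := List.append_inj hv (by rw [hW _ a.2, hW _ b.2])
          have hab : a = b := Subtype.ext e1
          rw [hab]
          exact (List.prefix_cons_inj b).2 (ih l' ⟨v, e2⟩)
    rintro l ⟨⟨ω, rfl⟩, -⟩ l' ⟨⟨ω', rfl⟩, -⟩ hne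
    exact ⟨fun h => hne (key _ _ (hgpre _ _ h)), fun h => hne (key _ _ (hgpre _ _ h)).symm⟩
  have hAcard : ∀ T : Finset (List W), (T : Set (List W)) ⊆ A → T.card ≤ N := by
    intro T hT
    have hinj : Set.InjOn g T := by
      intro l hl l' hl' he
      by_contra hne
      exact (hinc (hT hl) (hT hl') hne).1 (by rw [he])
    rw [← Finset.card_image_of_injOn hinj]
    refine hN x r hr (T.image g) ?_ ?_ ?_
    · intro u hu v hv huv
      rw [Finset.coe_image] at hu hv
      obtain ⟨l, hl, rfl⟩ := hu
      obtain ⟨l', hl', rfl⟩ := hv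
      exact hinc (hT hl) (hT hl') fun h => huv (by rw [h])
    · intro u hu
      obtain ⟨l, hl, rfl⟩ := Finset.mem_image.1 hu
      obtain ⟨⟨ω, rfl⟩, -⟩ := hT hl
      exact ⟨hκ' ω, hκ ω⟩
    · intro u hu
      obtain ⟨l, hl, rfl⟩ := Finset.mem_image.1 hu
      exact (hT hl).2
  have hAfin : A.Finite := by
    by_contra hinf
    obtain ⟨T, hTs, hTc⟩ := Set.Infinite.exists_subset_card_eq hinf (N + 1)
    have := hAcard T hTs
    omega
  have hcov : π ⁻¹' closedBall x r ⊆ ⋃ l ∈ hAfin.toFinset, {ω | pre ω (κ ω) = l} := by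
    intro ω hω
    refine mem_iUnion₂.2 ⟨pre ω (κ ω), ?_, rfl⟩
    rw [Set.Finite.mem_toFinset]
    exact ⟨⟨ω, rfl⟩, π ω, hπ ω _, hω⟩
  calc P (π ⁻¹' closedBall x r) ≤ _ := measure_mono hcov
    _ ≤ ∑ l ∈ hAfin.toFinset, P {ω | pre ω (κ ω) = l} := measure_biUnion_finset_le _ _
    _ ≤ ∑ l ∈ hAfin.toFinset, ENNReal.ofReal (r ^ s) := by
        refine Finset.sum_le_sum fun l hl => ?_
        obtain ⟨⟨ω, rfl⟩, -⟩ := hAfin.mem_toFinset.1 hl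
        calc P {ω' | pre ω' (κ ω') = pre ω (κ ω)}
            ≤ P {ω' | pre ω' (κ ω) = pre ω (κ ω)} := by
              refine measure_mono fun ω' (hω' : pre ω' (κ ω') = pre ω (κ ω)) => ?_
              have : κ ω' = κ ω := by
                rw [← hpre_len ω' (κ ω'), hω', hpre_len]
              rwa [this] at hω'
          _ ≤ _ := hcyl ω (κ ω)
          _ ≤ _ := ENNReal.ofReal_le_ofReal
              (Real.rpow_le_rpow (S.ratio_pos hd _).le (hκ ω) hs.le)
    _ = hAfin.toFinset.card * ENNReal.ofReal (r ^ s) := by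
        rw [Finset.sum_const, nsmul_eq_mul]
    _ ≤ _ := by
        gcongr
        have : (hAfin.toFinset.card : ℝ≥0∞) ≤ N := by
          exact_mod_cast hAcard hAfin.toFinset (by simp)
        exact this.trans le_self_add

/-- A finite sum exceeding one at `t` would, by continuity, exceed one at some `s > t`, giving
positive `ℋ^s`-measure above the dimension. -/
theorem sum_ratio_rpow_le (hd : 0 < d) {t : ℝ≥0} (ht : dimH S.limitSet = t) {n : ℕ} (hn : n ≠ 0)
    (W : Finset (List I)) (hW : ∀ w ∈ W, w.length = n) :
    ∑ w ∈ W, (S.ratio w / S.K) ^ (t : ℝ) ≤ 1 := by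
  by_contra! hlt
  have hcont : Continuous fun s : ℝ => ∑ w ∈ W, (S.ratio w / S.K) ^ s :=
    continuous_finsetSum _ fun w _ => Real.continuous_const_rpow
      (div_pos (S.ratio_pos hd w) S.K_pos).ne'
  have hev : ∀ᶠ s in 𝓝[>] (t : ℝ), 1 < ∑ w ∈ W, (S.ratio w / S.K) ^ s :=
    ((hcont.tendsto (t : ℝ)).eventually_const_lt hlt).filter_mono nhdsWithin_le_nhds
  obtain ⟨s, hs1, hs⟩ := (hev.and self_mem_nhdsWithin).exists
  have hs : (t : ℝ) < s := hs
  have hs0 : 0 < s := t.2.trans_lt hs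
  refine S.hausdorffMeasure_limitSet_ne_zero hd hn hs0 W hW hs1.le ?_
  have := hausdorffMeasure_of_dimH_lt (s := S.limitSet) (d := ⟨s, hs0.le⟩) (by
    rw [ht]
    exact ENNReal.coe_lt_coe.2 hs)
  exact this

/-- At exponent zero two letters already contribute `1 + 1 > 1` to the level sum. -/
theorem dimH_pos [Nontrivial I] (hd : 0 < d) {t : ℝ≥0} (ht : dimH S.limitSet = t) :
    (0 : ℝ) < t := by
  classical
  refine t.2.lt_of_ne' fun h0 => ?_
  obtain ⟨i, j, hij⟩ := exists_pair_ne I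
  have := S.sum_ratio_rpow_le hd ht one_ne_zero {[i], [j]} (by simp)
  rw [Finset.sum_pair (by simpa using hij), show (t : ℝ) = 0 from h0, Real.rpow_zero,
    Real.rpow_zero] at this
  norm_num at this

/-- Cover by the cylinders of one level: diameters are at most `D ρ_w`, so the level sum bound gives
`(D K)^t`, independently of the level. -/
theorem hausdorffMeasure_limitSet_lt_top [Countable I] (hd : 0 < d) {t : ℝ≥0}
    (ht : dimH S.limitSet = t) : μH[(t : ℝ)] S.limitSet < ∞ := by
  obtain ⟨D, hD, hdiam⟩ := S.exists_norm_F_sub_le hd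
  have hK := S.K_pos
  have hed : ∀ w, ediam (S.F w '' S.X) ≤ ENNReal.ofReal (D * S.ratio w) := by
    intro w
    refine ediam_le ?_
    rintro _ ⟨x, hx, rfl⟩ _ ⟨y, hy, rfl⟩
    rw [edist_dist, dist_eq_norm]
    exact ENNReal.ofReal_le_ofReal (hdiam w x hx y hy)
  have hle := Measure.hausdorffMeasure_le_liminf_tsum (t : ℝ) S.limitSet (l := atTop)
    (ι := fun n : ℕ => {w : List I // w.length = n + 1})
    (fun n : ℕ => ENNReal.ofReal (D * S.s ^ (n + 1))) (by
      have h1 : Tendsto (fun n : ℕ => D * S.s ^ (n + 1)) atTop (𝓝 (D * 0)) :=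
        ((tendsto_pow_atTop_nhds_zero_of_lt_one S.s_nonneg S.s_lt_one).comp
          (tendsto_add_atTop_nat 1)).const_mul D
      rw [mul_zero] at h1
      simpa [Function.comp_def] using (ENNReal.continuous_ofReal.tendsto 0).comp h1)
    (fun n w => S.F w '' S.X) (Eventually.of_forall fun n w => (hed w).trans
      (ENNReal.ofReal_le_ofReal (by
        gcongr
        exact (S.ratio_le_pow w).trans_eq (by rw [w.2]))))
    (Eventually.of_forall fun n x hx => by
      obtain ⟨w, hw, hxw⟩ := S.exists_word_of_mem_limitSet (n + 1) hx
      exact mem_iUnion.2 ⟨⟨w, hw⟩, image_mono S.limitSet_subset_X hxw⟩)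
  refine (hle.trans ?_).trans_lt (b := ENNReal.ofReal ((D * S.K) ^ (t : ℝ))) ENNReal.ofReal_lt_top
  refine liminf_le_of_le (by isBoundedDefault) fun b hb => ?_
  obtain ⟨n, hn⟩ := hb.exists
  refine hn.trans ?_
  rw [ENNReal.tsum_eq_iSup_sum]
  refine iSup_le fun W => ?_
  calc ∑ w ∈ W, ediam (S.F (w : List I) '' S.X) ^ (t : ℝ)
      ≤ ∑ w ∈ W, ENNReal.ofReal ((D * S.K) ^ (t : ℝ) * (S.ratio w / S.K) ^ (t : ℝ)) := by
        refine Finset.sum_le_sum fun w _ => ?_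
        have hr := S.ratio_pos hd (w : List I)
        rw [← Real.mul_rpow (by positivity) (by positivity),
          ← ENNReal.ofReal_rpow_of_nonneg (by positivity) t.coe_nonneg]
        refine ENNReal.rpow_le_rpow ((hed w).trans_eq ?_) t.coe_nonneg
        congr 1
        field_simp
    _ = ENNReal.ofReal ((D * S.K) ^ (t : ℝ) *
          ∑ w ∈ W.map (Function.Embedding.subtype _), (S.ratio w / S.K) ^ (t : ℝ)) := by
        rw [← ENNReal.ofReal_sum_of_nonneg, Finset.mul_sum, Finset.sum_map]
        · rfl
        · intro w _
          have hr := S.ratio_pos hd (w : List I)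
          positivity
    _ ≤ _ := by
        refine ENNReal.ofReal_le_ofReal (mul_le_of_le_one_right (by positivity) ?_)
        refine S.sum_ratio_rpow_le hd ht (Nat.succ_ne_zero n) _ fun w hw => ?_
        obtain ⟨a, -, rfl⟩ := Finset.mem_map.1 hw
        exact a.2

end CIFS

/-! ### Change of variables for Hausdorff measure -/

section ChangeOfVariables

theorem hausdorffMeasure_image_le_and_ge_of_norm_bounds {E : Type*} [NormedAddCommGroup E]
    [MeasurableSpace E] [BorelSpace E] {f : E → E} {p : Set E} {t b c : ℝ}
    (ht : 0 ≤ t) (hb : 0 < b) (hc : 0 ≤ c)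
    (h : ∀ x ∈ p, ∀ y ∈ p, b * ‖x - y‖ ≤ ‖f x - f y‖ ∧ ‖f x - f y‖ ≤ c * ‖x - y‖) :
    μH[t] (f '' p) ≤ ENNReal.ofReal (c ^ t) * μH[t] p ∧
      ENNReal.ofReal (b ^ t) * μH[t] p ≤ μH[t] (f '' p) := by
  constructor
  · have hl : LipschitzOnWith c.toNNReal f p := LipschitzOnWith.of_dist_le_mul fun x hx y hy => by
      rw [Real.coe_toNNReal _ hc, dist_eq_norm, dist_eq_norm]
      exact (h x hx y hy).2
    have := hl.hausdorffMeasure_image_le ht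
    rwa [← ENNReal.ofReal_rpow_of_nonneg hc ht]
  · rcases p.eq_empty_or_nonempty with rfl | ⟨x₀, _⟩
    · simp
    have hinj : InjOn f p := by
      intro x hx y hy hxy
      have := (h x hx y hy).1
      rw [hxy, sub_self, norm_zero] at this
      have h0 : ‖x - y‖ ≤ 0 := le_of_mul_le_mul_left (by rwa [mul_zero]) hb
      exact sub_eq_zero.1 (norm_le_zero_iff.1 h0)
    have : Nonempty E := ⟨x₀⟩
    have hl : LipschitzOnWith b⁻¹.toNNReal (Function.invFunOn f p) (f '' p) := by
      refine LipschitzOnWith.of_dist_le_mul ?_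
      rintro _ ⟨x, hx, rfl⟩ _ ⟨y, hy, rfl⟩
      rw [hinj.leftInvOn_invFunOn hx, hinj.leftInvOn_invFunOn hy,
        Real.coe_toNNReal _ (inv_pos.2 hb).le, dist_eq_norm, dist_eq_norm, ← div_eq_inv_mul,
        le_div_iff₀' hb]
      exact (h x hx y hy).1
    have h1 := hl.hausdorffMeasure_image_le ht
    rw [hinj.leftInvOn_invFunOn.image_image] at h1
    calc ENNReal.ofReal (b ^ t) * μH[t] p
        ≤ ENNReal.ofReal (b ^ t) * (ENNReal.ofReal b⁻¹ ^ t * μH[t] (f '' p)) := by gcongr; exact h1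
      _ = μH[t] (f '' p) := by
        rw [← mul_assoc, ENNReal.ofReal_rpow_of_nonneg (inv_pos.2 hb).le ht,
          ← ENNReal.ofReal_mul (by positivity), Real.inv_rpow hb.le,
          mul_inv_cancel₀ (Real.rpow_pos_of_pos hb t).ne', ENNReal.ofReal_one, one_mul]

variable {E : Type*} [NormedAddCommGroup E] [NormedSpace ℝ E] [FiniteDimensional ℝ E]
  [MeasurableSpace E] [BorelSpace E]

/-- Differentiability alone splits `s` into countably many measurable pieces on which `f` is close
to one similarity of ratio in `[a, q a]`, hence bi-Lipschitz with constants `a / q` and `q² a`. -/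
theorem hausdorffMeasure_image_bounds_of_norm_fderiv_mem_Icc {f : E → E} {s : Set E} {t a q : ℝ}
    (ht : 0 ≤ t) (ha : 0 < a) (hq : 1 < q) (hs : MeasurableSet s)
    (hd : ∀ x ∈ s, DifferentiableAt ℝ f x) (hinj : InjOn f s)
    (hsim : ∀ x ∈ s, ∀ v, ‖fderiv ℝ f x v‖ = ‖fderiv ℝ f x‖ * ‖v‖)
    (hn : ∀ x ∈ s, ‖fderiv ℝ f x‖ ∈ Icc a (q * a)) :
    μH[t] (f '' s) ≤
        ENNReal.ofReal (q ^ (2 * t)) * ∫⁻ x in s, ENNReal.ofReal (‖fderiv ℝ f x‖ ^ t) ∂μH[t] ∧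
      ∫⁻ x in s, ENNReal.ofReal (‖fderiv ℝ f x‖ ^ t) ∂μH[t] ≤
        ENNReal.ofReal (q ^ (2 * t)) * μH[t] (f '' s) := by
  rcases s.eq_empty_or_nonempty with rfl | hne
  · simp
  have hq0 : 0 < q := one_pos.trans hq
  -- Chosen so that `a - η = a / q` exactly, while `q a + η ≤ q² a`.
  set η : ℝ := a * (1 - q⁻¹) with hη
  have hq1 : q⁻¹ < 1 := inv_lt_one_of_one_lt₀ hq
  have hη0 : 0 < η := mul_pos ha (by linarith)
  obtain ⟨T, A, hTd, hTm, hTs, hA, hA'⟩ :=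
    exists_partition_approximatesLinearOn_of_hasFDerivWithinAt f s (fderiv ℝ f)
      (fun x hx => (hd x hx).hasFDerivAt.hasFDerivWithinAt) (fun _ => ⟨η, hη0.le⟩)
      (fun _ => (NNReal.coe_pos.1 hη0 : (0 : ℝ≥0) < ⟨η, hη0.le⟩).ne')
  have hpiece : ∀ n, ∀ x ∈ s ∩ T n, ∀ y ∈ s ∩ T n,
      a / q * ‖x - y‖ ≤ ‖f x - f y‖ ∧ ‖f x - f y‖ ≤ q ^ 2 * a * ‖x - y‖ := by
    intro n x hx y hy
    obtain ⟨z, hz, hzA⟩ := hA' hne n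
    have h1 : ‖f x - f y - A n (x - y)‖ ≤ η * ‖x - y‖ := hA n x hx y hy
    have h2 : ‖A n (x - y)‖ = ‖A n‖ * ‖x - y‖ := by rw [hzA]; exact hsim z hz _
    have h3 : a * ‖x - y‖ ≤ ‖A n‖ * ‖x - y‖ := by
      gcongr; rw [hzA]; exact (hn z hz).1
    have h4 : ‖A n‖ * ‖x - y‖ ≤ q * a * ‖x - y‖ := by
      gcongr; rw [hzA]; exact (hn z hz).2
    have h5 := norm_sub_norm_le (A n (x - y)) (f x - f y)
    rw [norm_sub_rev (A n (x - y))] at h5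
    have h6 := norm_sub_norm_le (f x - f y) (A n (x - y))
    have e1 : a / q = a - η := by rw [hη]; ring
    have e2 : q * a + η ≤ q ^ 2 * a := by
      have h7 : (q ^ 2 * a - q * a) - η = a * (q - 1) * (q - q⁻¹) := by
        rw [hη]; field_simp
      have : 0 ≤ a * (q - 1) * (q - q⁻¹) :=
        mul_nonneg (mul_nonneg ha.le (by linarith)) (by linarith)
      linarith
    refine ⟨by rw [e1, sub_mul]; linarith, ?_⟩
    have : (q * a + η) * ‖x - y‖ ≤ q ^ 2 * a * ‖x - y‖ := by gcongr
    linarith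
  have hmem : ∀ n, MeasurableSet (s ∩ T n) := fun n => hs.inter (hTm n)
  have hsU : s = ⋃ n, s ∩ T n := by rw [← inter_iUnion, inter_eq_left.2 hTs]
  have hsum : μH[t] s = ∑' n, μH[t] (s ∩ T n) := by
    conv_lhs => rw [hsU]
    exact measure_iUnion (fun i j hij => (hTd hij).mono inter_subset_right inter_subset_right) hmem
  have hsum' : μH[t] (f '' s) = ∑' n, μH[t] (f '' (s ∩ T n)) := by
    conv_lhs => rw [hsU, image_iUnion]
    refine measure_iUnion (fun i j hij => ?_) fun n => ?_
    · simp only [Function.onFun]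
      rw [disjoint_left]
      rintro _ ⟨x, hx, rfl⟩ ⟨y, hy, hyx⟩
      rw [hinj hy.1 hx.1 hyx] at hy
      exact disjoint_left.1 (hTd hij) hx.2 hy.2
    · exact measurable_image_of_fderivWithin (hmem n)
        (fun x hx => (hd x hx.1).hasFDerivAt.hasFDerivWithinAt) (hinj.mono inter_subset_left)
  have hup : μH[t] (f '' s) ≤ ENNReal.ofReal ((q ^ 2 * a) ^ t) * μH[t] s := by
    rw [hsum, hsum', ← ENNReal.tsum_mul_left]
    exact ENNReal.tsum_le_tsum fun n => (hausdorffMeasure_image_le_and_ge_of_norm_bounds ht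
      (by positivity) (by positivity) (hpiece n)).1
  have hlo : ENNReal.ofReal ((a / q) ^ t) * μH[t] s ≤ μH[t] (f '' s) := by
    rw [hsum, hsum', ← ENNReal.tsum_mul_left]
    exact ENNReal.tsum_le_tsum fun n => (hausdorffMeasure_image_le_and_ge_of_norm_bounds ht
      (by positivity) (c := q ^ 2 * a) (by positivity) (hpiece n)).2
  constructor
  · calc μH[t] (f '' s) ≤ _ := hup
      _ = ENNReal.ofReal (q ^ (2 * t)) * (ENNReal.ofReal (a ^ t) * μH[t] s) := by
          rw [← mul_assoc, ← ENNReal.ofReal_mul (by positivity), Real.mul_rpow (by positivity)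
            ha.le, Real.rpow_mul hq0.le, Real.rpow_two]
      _ ≤ _ := by
          gcongr
          rw [← setLIntegral_const]
          refine setLIntegral_mono' hs fun x hx => ENNReal.ofReal_le_ofReal ?_
          exact Real.rpow_le_rpow ha.le (hn x hx).1 ht
  · calc ∫⁻ x in s, ENNReal.ofReal (‖fderiv ℝ f x‖ ^ t) ∂μH[t]
        ≤ ENNReal.ofReal ((q * a) ^ t) * μH[t] s := by
          rw [← setLIntegral_const]
          refine setLIntegral_mono' hs fun x hx => ENNReal.ofReal_le_ofReal ?_
          exact Real.rpow_le_rpow (norm_nonneg _) (hn x hx).2 ht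
      _ = ENNReal.ofReal (q ^ (2 * t)) * (ENNReal.ofReal ((a / q) ^ t) * μH[t] s) := by
          rw [← mul_assoc, ← ENNReal.ofReal_mul (by positivity), Real.rpow_mul hq0.le,
            ← Real.mul_rpow (by positivity) (by positivity), Real.rpow_two]
          congr 3
          field_simp
      _ ≤ _ := by gcongr

/-- Change of variables for Hausdorff measures and differentiable injective maps whose derivatives
are similarities. -/
theorem hausdorffMeasure_image_eq_lintegral {f : E → E} {s : Set E} {t : ℝ} (ht : 0 ≤ t)
    (hs : MeasurableSet s) (hd : ∀ x ∈ s, DifferentiableAt ℝ f x) (hinj : InjOn f s)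
    (hsim : ∀ x ∈ s, ∀ v, ‖fderiv ℝ f x v‖ = ‖fderiv ℝ f x‖ * ‖v‖)
    (hpos : ∀ x ∈ s, 0 < ‖fderiv ℝ f x‖) :
    μH[t] (f '' s) = ∫⁻ x in s, ENNReal.ofReal (‖fderiv ℝ f x‖ ^ t) ∂μH[t] := by
  set J := ∫⁻ x in s, ENNReal.ofReal (‖fderiv ℝ f x‖ ^ t) ∂μH[t] with hJ
  have key : ∀ q : ℝ, 1 < q → μH[t] (f '' s) ≤ ENNReal.ofReal (q ^ (2 * t)) * J ∧
      J ≤ ENNReal.ofReal (q ^ (2 * t)) * μH[t] (f '' s) := by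
    intro q hq
    have hq0 : 0 < q := one_pos.trans hq
    -- On a geometric level set the norm varies by a factor at most `q`; summing over levels keeps
    -- the error `q ^ (2 t)`, which tends to one as `q` decreases to one.
    let p : ℤ → Set E := fun k => s ∩ {x | ‖fderiv ℝ f x‖ ∈ Ico (q ^ k) (q ^ (k + 1))}
    have hpm : ∀ k, MeasurableSet (p k) := fun k =>
      hs.inter ((measurable_fderiv ℝ f).norm measurableSet_Ico)
    have hpd : Pairwise (Function.onFun Disjoint p) := by
      have h0 := (zpow_right_mono₀ hq.le).pairwise_disjoint_on_Ico_succ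
      intro i j hij
      simp only [Function.onFun]
      rw [disjoint_left]
      rintro x ⟨_, hx⟩ ⟨_, hx'⟩
      exact disjoint_left.1 (h0 hij) hx hx'
    have hpU : s = ⋃ k, p k := by
      refine Subset.antisymm (fun x hx => ?_) (iUnion_subset fun k => inter_subset_left)
      obtain ⟨k, hk⟩ := exists_mem_Ico_zpow (hpos x hx) hq
      exact mem_iUnion.2 ⟨k, hx, hk⟩
    have hJs : J = ∑' k, ∫⁻ x in p k, ENNReal.ofReal (‖fderiv ℝ f x‖ ^ t) ∂μH[t] := by
      rw [hJ]
      conv_lhs => rw [hpU]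
      exact lintegral_iUnion hpm hpd _
    have hHs : μH[t] (f '' s) = ∑' k, μH[t] (f '' p k) := by
      conv_lhs => rw [hpU, image_iUnion]
      refine measure_iUnion (fun i j hij => ?_) fun n => ?_
      · simp only [Function.onFun]
        rw [disjoint_left]
        rintro _ ⟨x, hx, rfl⟩ ⟨y, hy, hyx⟩
        rw [hinj hy.1 hx.1 hyx] at hy
        exact disjoint_left.1 (hpd hij) hx hy
      · exact measurable_image_of_fderivWithin (hpm n)
          (fun x hx => (hd x hx.1).hasFDerivAt.hasFDerivWithinAt) (hinj.mono inter_subset_left)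
    have hk : ∀ k, _ := fun k => hausdorffMeasure_image_bounds_of_norm_fderiv_mem_Icc ht
      (zpow_pos hq0 k) hq (hpm k) (fun x hx => hd x hx.1) (hinj.mono inter_subset_left)
      (fun x hx => hsim x hx.1) (fun x hx => ⟨hx.2.1, by
        have := hx.2.2.le
        rwa [zpow_add_one₀ hq0.ne', mul_comm] at this⟩)
    rw [hHs, hJs, ← ENNReal.tsum_mul_left, ← ENNReal.tsum_mul_left]
    exact ⟨ENNReal.tsum_le_tsum fun k => (hk k).1, ENNReal.tsum_le_tsum fun k => (hk k).2⟩
  have hlim : ∀ c : ℝ≥0∞, Tendsto (fun q : ℝ => ENNReal.ofReal (q ^ (2 * t)) * c) (𝓝[>] 1)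
      (𝓝 c) := by
    intro c
    have h1 : Tendsto (fun q : ℝ => q ^ (2 * t)) (𝓝[>] 1) (𝓝 1) := by
      have := (Real.continuousAt_rpow_const 1 (2 * t) (Or.inl one_ne_zero)).tendsto
      rw [Real.one_rpow] at this
      exact this.mono_left nhdsWithin_le_nhds
    have h2 := ENNReal.Tendsto.mul_const (b := c)
      ((ENNReal.continuous_ofReal.tendsto 1).comp h1) (by simp)
    simpa [Function.comp_def] using h2
  refine le_antisymm (ge_of_tendsto (hlim _) ?_) (ge_of_tendsto (hlim _) ?_)
  · filter_upwards [self_mem_nhdsWithin] with q hq using (key q hq).1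
  · filter_upwards [self_mem_nhdsWithin] with q hq using (key q hq).2

end ChangeOfVariables

/-! ### Null overlaps and conformal measures -/

namespace CIFS

open Metric Module

variable {d : ℕ} {I : Type*} (S : CIFS d I)

theorem hausdorffMeasure_F_image (hd : 0 < d) {t : ℝ} (ht : 0 ≤ t) (w : List I)
    {A : Set (EuclideanSpace ℝ (Fin d))} (hA : MeasurableSet A) (hAΩ : A ⊆ S.Ω) :
    μH[t] (S.F w '' A) = ∫⁻ x in A, ENNReal.ofReal (‖fderiv ℝ (S.F w) x‖ ^ t) ∂μH[t] :=
  hausdorffMeasure_image_eq_lintegral ht hA (fun _ hx => S.differentiableAt_F hd w (hAΩ hx))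
    ((S.injOn_F w).mono hAΩ) (fun _ hx => S.norm_fderiv_apply hd w (hAΩ hx))
    (fun _ hx => S.norm_fderiv_pos hd w (hAΩ hx))

theorem lintegral_fderiv_rpow_le {t : ℝ} (ht : 0 ≤ t) (w : List I)
    (m : Measure (EuclideanSpace ℝ (Fin d)))
    {A : Set (EuclideanSpace ℝ (Fin d))} (hA : MeasurableSet A) (hAΩ : A ⊆ S.Ω) :
    ∫⁻ x in A, ENNReal.ofReal (‖fderiv ℝ (S.F w) x‖ ^ t) ∂m ≤
      ENNReal.ofReal ((S.K * S.ratio w) ^ t) * m A := by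
  rw [← setLIntegral_const]
  exact setLIntegral_mono' hA fun x hx => ENNReal.ofReal_le_ofReal
    (Real.rpow_le_rpow (norm_nonneg _) (S.norm_fderiv_le w (hAΩ hx)) ht)

theorem le_hausdorffMeasure_F_image (hd : 0 < d) {t : ℝ} (ht : 0 ≤ t) (w : List I)
    {A : Set (EuclideanSpace ℝ (Fin d))} (hA : MeasurableSet A) (hAΩ : A ⊆ S.Ω) :
    ENNReal.ofReal ((S.ratio w / S.K) ^ t) * μH[t] A ≤ μH[t] (S.F w '' A) := by
  rw [S.hausdorffMeasure_F_image hd ht w hA hAΩ, ← setLIntegral_const]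
  exact setLIntegral_mono' hA fun x hx => ENNReal.ofReal_le_ofReal
    (Real.rpow_le_rpow (div_pos (S.ratio_pos hd w) S.K_pos).le (S.le_norm_fderiv w (hAΩ hx)) ht)

theorem hausdorffMeasure_F_image_le (hd : 0 < d) {t : ℝ} (ht : 0 ≤ t) (w : List I)
    {A : Set (EuclideanSpace ℝ (Fin d))} (hA : MeasurableSet A) (hAΩ : A ⊆ S.Ω) :
    μH[t] (S.F w '' A) ≤ ENNReal.ofReal ((S.K * S.ratio w) ^ t) * μH[t] A := by
  rw [S.hausdorffMeasure_F_image hd ht w hA hAΩ]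
  exact S.lintegral_fderiv_rpow_le ht w _ hA hAΩ

theorem ofReal_mul_ratio_rpow (hd : 0 < d) (t : ℝ) (w : List I) :
    ENNReal.ofReal ((S.K * S.ratio w) ^ t) =
      ENNReal.ofReal ((S.K ^ 2) ^ t) * ENNReal.ofReal ((S.ratio w / S.K) ^ t) := by
  have hK := S.K_pos
  have hr := S.ratio_pos hd w
  rw [← ENNReal.ofReal_mul (by positivity), ← Real.mul_rpow (by positivity) (by positivity)]
  congr 2
  field_simp

theorem exists_length_diam_lt {δ : ℝ} (hδ : 0 < δ) : ∃ n : ℕ, n ≠ 0 ∧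
    ∀ w : List I, w.length = n → ∀ x ∈ S.X, ∀ y ∈ S.X, dist (S.F w x) (S.F w y) < δ := by
  have h1 : Tendsto (fun n : ℕ => S.s ^ n * diam S.X) atTop (𝓝 0) := by
    simpa using (tendsto_pow_atTop_nhds_zero_of_lt_one S.s_nonneg S.s_lt_one).mul_const (diam S.X)
  obtain ⟨n, hn, hn0⟩ := ((h1.eventually_lt_const hδ).and (eventually_ne_atTop 0)).exists
  refine ⟨n, hn0, fun w hw x hx y hy => lt_of_le_of_lt ?_ hn⟩
  rw [dist_eq_norm, ← hw]
  refine (S.norm_F_sub_le w (S.X_subset_Ω hx) (S.X_subset_Ω hy)).trans ?_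
  rw [← dist_eq_norm]
  exact mul_le_mul_of_nonneg_left (dist_le_diam_of_mem S.isCompact_X.isBounded hx hy)
    (pow_nonneg S.s_nonneg _)

/-- A measure carried by the limit set is bounded by another one as soon as this holds on the
cylinders. -/
theorem measure_le_of_cylinders_le [Countable I] (hd : 0 < d)
    (m n : Measure (EuclideanSpace ℝ (Fin d)))
    [IsFiniteMeasure m] [IsFiniteMeasure n] (hm : m (S.limitSet)ᶜ = 0)
    {G : Set (EuclideanSpace ℝ (Fin d))} (hG : MeasurableSet G) (hGE : G ⊆ S.limitSet)
    (hle : ∀ w : List I, w ≠ [] → m (S.F w '' S.limitSet) ≤ n (S.F w '' G))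
    (hdisj : ∀ w v : List I, Incomparable w v → n (S.F w '' G ∩ S.F v '' G) = 0)
    {B : Set (EuclideanSpace ℝ (Fin d))} (hB : MeasurableSet B) : m B ≤ n B := by
  have hopen : ∀ C U : Set (EuclideanSpace ℝ (Fin d)), IsCompact C → IsOpen U → C ⊆ U →
      m C ≤ n U := by
    intro C U hC hU hCU
    obtain ⟨δ, hδ, hδU⟩ := hC.exists_thickening_subset_open hU hCU
    -- Cylinders of this level that meet `C` stay inside `U`; they cover `C ∩ E`, and their
    -- `G`-parts overlap in `n`-null sets, so the cylinder bounds add up.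
    obtain ⟨k, hk0, hk⟩ := S.exists_length_diam_lt hδ
    let W : Set (List I) := {w | w.length = k ∧ (S.F w '' S.X ∩ C).Nonempty}
    have hcov : C ∩ S.limitSet ⊆ ⋃ w : W, S.F w '' S.limitSet := by
      rintro x ⟨hxC, hxE⟩
      obtain ⟨w, hw, hxw⟩ := S.exists_word_of_mem_limitSet k hxE
      exact mem_iUnion.2 ⟨⟨w, hw, x, image_mono S.limitSet_subset_X hxw, hxC⟩, hxw⟩
    have hWU : ∀ w : W, S.F w '' G ⊆ U := by
      rintro ⟨w, hw, _, ⟨y, hy, rfl⟩, hyC⟩ _ ⟨z, hz, rfl⟩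
      exact hδU (mem_thickening_iff.2 ⟨_, hyC, hk w hw z
        (S.limitSet_subset_X (hGE hz)) y hy⟩)
    calc m C ≤ m (C ∩ S.limitSet) + m (S.limitSet)ᶜ := by
          refine (measure_mono (fun x hx => ?_)).trans (measure_union_le _ _)
          by_cases hxE : x ∈ S.limitSet
          exacts [Or.inl ⟨hx, hxE⟩, Or.inr hxE]
      _ ≤ ∑' w : W, m (S.F w '' S.limitSet) := by
          rw [hm, add_zero]
          exact (measure_mono hcov).trans (measure_iUnion_le _)
      _ ≤ ∑' w : W, n (S.F w '' G) := by
          refine ENNReal.tsum_le_tsum fun w => hle w ?_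
          intro h0
          have := w.2.1
          rw [h0] at this
          exact hk0 this.symm
      _ = n (⋃ w : W, S.F w '' G) := by
          refine (measure_iUnion₀ (fun w v hwv => ?_) fun w => ?_).symm
          · exact hdisj _ _ (incomparable_of_length_eq (w.2.1.trans v.2.1.symm)
              (fun h => hwv (Subtype.ext h)))
          · exact (S.measurableSet_F_image hd w hG
              (hGE.trans S.limitSet_subset_Ω)).nullMeasurableSet
      _ ≤ n U := measure_mono (iUnion_subset hWU)
  have hcomp : ∀ C, IsCompact C → m C ≤ n C := by
    intro C hC
    refine ENNReal.le_of_forall_pos_le_add fun ε hε _ => ?_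
    obtain ⟨U, hCU, hU, hle⟩ := C.exists_isOpen_le_add n (ENNReal.coe_pos.2 hε).ne'
    exact (hopen C U hC hU hCU).trans hle
  rw [hB.measure_eq_iSup_isCompact_of_ne_top (measure_ne_top m B)]
  exact iSup₂_le fun C hCB => iSup_le fun hC => (hcomp C hC).trans (measure_mono hCB)

/-- The points lying in `k` of the sets `φ_w(X)`, for pairwise incomparable words `w`. -/
def multiplePoints (k : ℕ) : Set (EuclideanSpace ℝ (Fin d)) :=
  {x | ∃ T : Finset (List I), (T : Set (List I)).Pairwise Incomparable ∧ T.card = k ∧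
    ∀ u ∈ T, x ∈ S.F u '' S.X}

theorem measurableSet_multiplePoints [Countable I] (k : ℕ) :
    MeasurableSet (S.multiplePoints k) := by
  have : S.multiplePoints k = ⋃ T ∈ {T : Finset (List I) |
      (T : Set (List I)).Pairwise Incomparable ∧ T.card = k}, ⋂ u ∈ T, S.F u '' S.X := by
    ext x
    simp only [multiplePoints, mem_ofPred_eq, mem_iUnion, mem_iInter, exists_prop, and_assoc]
  rw [this]
  exact MeasurableSet.biUnion (to_countable _) fun T _ =>
    Finset.measurableSet_biInter T fun u _ => (S.isCompact_F_X u).measurableSet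

theorem F_mem_multiplePoints {w : List I} {k : ℕ} {x : EuclideanSpace ℝ (Fin d)}
    (hx : x ∈ S.multiplePoints k) : S.F w x ∈ S.multiplePoints k := by
  classical
  obtain ⟨T, hT, hk, hxT⟩ := hx
  refine ⟨T.image (w ++ ·), ?_, ?_, ?_⟩
  · rw [Finset.coe_image]
    rintro _ ⟨u, hu, rfl⟩ _ ⟨v, hv, rfl⟩ huv
    exact (hT hu hv fun h => huv (by rw [h])).append_left w
  · rw [Finset.card_image_of_injective _ (List.append_right_injective w), hk]
  · intro u hu
    obtain ⟨v, hv, rfl⟩ := Finset.mem_image.1 hu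
    obtain ⟨y, hy, rfl⟩ := hxT v hv
    exact ⟨y, hy, S.F_append w v y⟩

/-- Prefixing `w` keeps the `k` words of `x` incomparable to each other and to `v`, so a cylinder
overlap raises the multiplicity by one. -/
theorem F_mem_multiplePoints_succ {w v : List I} (hwv : Incomparable w v) {k : ℕ}
    {x : EuclideanSpace ℝ (Fin d)} (hx : x ∈ S.multiplePoints k) (hv : S.F w x ∈ S.F v '' S.X) :
    S.F w x ∈ S.multiplePoints (k + 1) := by
  classical
  obtain ⟨T, hT, hk, hxT⟩ := hx
  have hinc : ∀ u, Incomparable (w ++ u) v := hwv.append_right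
  refine ⟨insert v (T.image (w ++ ·)), ?_, ?_, ?_⟩
  · rw [Finset.coe_insert, Finset.coe_image]
    refine (Set.pairwise_insert).2 ⟨?_, ?_⟩
    · rintro _ ⟨u, hu, rfl⟩ _ ⟨v, hv, rfl⟩ huv
      exact (hT hu hv fun h => huv (by rw [h])).append_left w
    · rintro _ ⟨u, hu, rfl⟩ _
      exact ⟨(hinc u).symm, hinc u⟩
  · rw [Finset.card_insert_of_notMem, Finset.card_image_of_injective _
      (List.append_right_injective w), hk]
    intro h
    obtain ⟨u, -, hu⟩ := Finset.mem_image.1 h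
    exact (hinc u).1 (by rw [← hu])
  · intro u hu
    rcases Finset.mem_insert.1 hu with rfl | hu
    · exact hv
    · obtain ⟨v', hv', rfl⟩ := Finset.mem_image.1 hu
      obtain ⟨y, hy, rfl⟩ := hxT v' hv'
      exact ⟨y, hy, S.F_append w v' y⟩

/-- Overlaps are negligible: `φ_w(E) ∩ φ_v(X)` is a null set for incomparable words `w`, `v`. -/
theorem hausdorffMeasure_overlap_eq_zero [Countable I] (hd : 0 < d) {t : ℝ} (ht : 0 ≤ t)
    (hfin : μH[t] S.limitSet ≠ ∞) {w v : List I} (hwv : Incomparable w v) :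
    μH[t] (S.F w '' S.limitSet ∩ S.F v '' S.X) = 0 := by
  set E := S.limitSet with hE
  have hEm : MeasurableSet E := S.measurableSet_limitSet hd
  have hFE : ∀ w, S.F w '' E ⊆ E := fun w => (S.mapsTo_F_limitSet w).image_subset
  by_cases hE0 : μH[t] E = 0
  · exact measure_mono_null (inter_subset_left.trans (hFE w)) hE0
  -- Multiplicity zero gives all of `E`, and multiplicities beyond the uniform bound are impossible,
  -- so there is a last non-null multiplicity.
  obtain ⟨k, hk1, hk2⟩ : ∃ k, μH[t] (E ∩ S.multiplePoints k) ≠ 0 ∧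
      μH[t] (E ∩ S.multiplePoints (k + 1)) = 0 := by
    by_contra! hno
    obtain ⟨N, hN⟩ := S.exists_multiplicity_bound hd
    have h1 : ∀ k, μH[t] (E ∩ S.multiplePoints k) ≠ 0 := by
      intro k
      induction k with
      | zero =>
        have : E ∩ S.multiplePoints 0 = E := inter_eq_left.2 fun x _ => ⟨∅, by simp, by simp⟩
        rwa [this]
      | succ k ih => exact hno k ih
    refine h1 (N + 1) ?_
    have : S.multiplePoints (N + 1) = ∅ := by
      rw [eq_empty_iff_forall_notMem]
      rintro x ⟨T, hT, hk, hxT⟩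
      have := hN x T hT hxT
      omega
    rw [this, inter_empty, measure_empty]
  set G := E ∩ S.multiplePoints k with hG
  have hGm : MeasurableSet G := hEm.inter (S.measurableSet_multiplePoints k)
  have hGE : G ⊆ E := inter_subset_left
  have hGΩ : G ⊆ S.Ω := hGE.trans S.limitSet_subset_Ω
  have hFG : ∀ w, S.F w '' G ⊆ G := by
    rintro w _ ⟨x, hx, rfl⟩
    exact ⟨S.mapsTo_F_limitSet w hx.1, S.F_mem_multiplePoints hx.2⟩
  have hGov : ∀ w v : List I, Incomparable w v → μH[t] (S.F w '' G ∩ S.F v '' S.X) = 0 := by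
    intro w v hwv
    refine measure_mono_null ?_ hk2
    rintro _ ⟨⟨x, hx, rfl⟩, hxv⟩
    exact ⟨S.mapsTo_F_limitSet w hx.1, S.F_mem_multiplePoints_succ hwv hx.2 hxv⟩
  have hGfin : μH[t] G ≠ ∞ := measure_ne_top_of_subset hGE hfin
  set C : ℝ≥0∞ := ENNReal.ofReal ((S.K ^ 2) ^ t) * (μH[t] E / μH[t] G) with hC
  have hCfin : C ≠ ∞ := ENNReal.mul_ne_top ENNReal.ofReal_ne_top (ENNReal.div_ne_top hfin hk1)
  have hf1 : IsFiniteMeasure ((μH[t] : Measure (EuclideanSpace ℝ (Fin d))).restrict E) :=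
    ⟨by rw [Measure.restrict_apply_univ]; exact hfin.lt_top⟩
  have hf2 : IsFiniteMeasure (C • (μH[t] : Measure (EuclideanSpace ℝ (Fin d))).restrict G) :=
    ⟨by
      rw [Measure.smul_apply, Measure.restrict_apply_univ, smul_eq_mul]
      exact ENNReal.mul_lt_top hCfin.lt_top hGfin.lt_top⟩
  -- The invariant set `G` takes, up to the factor `C`, the same share of each cylinder as of `E`,
  -- and its own overlaps are null. Cylinder comparison bounds `ℋ^t` on `E` by `C ℋ^t` on `G`;
  -- evaluating on the complement of `G` gives zero.
  have hGfull : μH[t] (E \ G) = 0 := by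
    have h := S.measure_le_of_cylinders_le hd ((μH[t] : Measure _).restrict E)
      (C • (μH[t] : Measure _).restrict G)
      (by rw [Measure.restrict_apply hEm.compl, compl_inter_self, measure_empty]) hGm hGE
      (fun w _ => by
        rw [Measure.restrict_eq_self _ (hFE w), Measure.smul_apply,
          Measure.restrict_eq_self _ (hFG w), smul_eq_mul]
        calc μH[t] (S.F w '' E) ≤ ENNReal.ofReal ((S.K * S.ratio w) ^ t) * μH[t] E :=
              S.hausdorffMeasure_F_image_le hd ht w hEm S.limitSet_subset_Ω
          _ = C * (ENNReal.ofReal ((S.ratio w / S.K) ^ t) * μH[t] G) := by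
              have e : μH[t] E = μH[t] E / μH[t] G * μH[t] G :=
                (ENNReal.div_mul_cancel hk1 hGfin).symm
              rw [S.ofReal_mul_ratio_rpow hd, hC]
              conv_lhs => rw [e]
              ring
          _ ≤ _ := by
              gcongr
              exact S.le_hausdorffMeasure_F_image hd ht w hGm hGΩ)
      (fun w v hwv => by
        rw [Measure.smul_apply, smul_eq_mul]
        refine mul_eq_zero_of_right _ (measure_mono_null ?_
          (Measure.absolutelyContinuous_of_le Measure.restrict_le_self (hGov w v hwv)))
        exact inter_subset_inter_right _ (image_mono (hGE.trans S.limitSet_subset_X)))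
      (hGm.compl)
    rw [Measure.smul_apply, Measure.restrict_apply hGm.compl, Measure.restrict_apply hGm.compl,
      compl_inter_self, measure_empty, smul_zero, inter_comm, ← sdiff_eq] at h
    exact le_antisymm h (zero_le)
  refine measure_mono_null (t := S.F w '' (E \ G) ∪ (S.F w '' G ∩ S.F v '' S.X)) ?_
    (measure_union_null ?_ (hGov w v hwv))
  · rintro _ ⟨⟨x, hx, rfl⟩, hxv⟩
    by_cases hxG : x ∈ G
    exacts [Or.inr ⟨⟨x, hxG, rfl⟩, hxv⟩, Or.inl ⟨x, ⟨hx, hxG⟩, rfl⟩]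
  · have := S.hausdorffMeasure_F_image_le hd ht w (hEm.diff hGm)
      (sdiff_subset.trans S.limitSet_subset_Ω)
    rw [hGfull, mul_zero] at this
    exact le_antisymm this (zero_le)

/-- The normalised Hausdorff measure on the limit set is conformal. -/
theorem isConformalMeasure_hausdorffMeasure [Countable I] (hd : 0 < d) {t : ℝ} (ht : 0 ≤ t)
    (h0 : μH[t] S.limitSet ≠ 0) (hfin : μH[t] S.limitSet ≠ ∞) :
    S.IsConformalMeasure t ((μH[t] S.limitSet)⁻¹ • (μH[t] : Measure _).restrict S.limitSet) := by
  set E := S.limitSet with hE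
  have hEm : MeasurableSet E := S.measurableSet_limitSet hd
  refine ⟨⟨?_⟩, ?_, ?_⟩
  · rw [Measure.smul_apply, Measure.restrict_apply_univ, smul_eq_mul,
      ENNReal.inv_mul_cancel h0 hfin]
  · rw [Measure.smul_apply, Measure.restrict_apply hEm.compl, compl_inter_self, measure_empty,
      smul_zero]
  · intro w _ A hAX hA
    have hAm := S.measurableSet_F_image hd w hA (hAX.trans S.X_subset_Ω)
    rw [Measure.smul_apply, Measure.restrict_apply hAm, Measure.restrict_smul,
      lintegral_smul_measure, Measure.restrict_restrict hA,
      ← S.hausdorffMeasure_F_image hd ht w (hA.inter hEm)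
        (inter_subset_left.trans (hAX.trans S.X_subset_Ω))]
    congr 1
    refine le_antisymm ?_ (measure_mono ?_)
    -- A point of `φ_w(A) ∩ E` outside `φ_w(A ∩ E)` must be coded by another word of the same
    -- length, and so lies in a null overlap.
    · have hsub : S.F w '' A ∩ E ⊆ S.F w '' (A ∩ E) ∪
          ⋃ v ∈ {v : List I | v.length = w.length ∧ v ≠ w}, S.F v '' E ∩ S.F w '' S.X := by
        rintro _ ⟨⟨x, hx, rfl⟩, hxE⟩
        obtain ⟨v, hv, y, hy, hyx⟩ := S.exists_word_of_mem_limitSet w.length hxE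
        by_cases hvw : v = w
        · left
          subst hvw
          have : y = x := S.injOn_F v (S.limitSet_subset_Ω hy) (S.X_subset_Ω (hAX hx)) hyx
          subst this
          exact ⟨y, ⟨hx, hy⟩, rfl⟩
        · exact Or.inr (mem_iUnion₂.2 ⟨v, ⟨hv, hvw⟩, ⟨y, hy, hyx⟩, x, hAX hx, rfl⟩)
      refine (measure_mono hsub).trans ((measure_union_le _ _).trans ?_)
      rw [(measure_biUnion_null_iff (to_countable _)).2 fun v hv =>
        S.hausdorffMeasure_overlap_eq_zero hd ht hfin (incomparable_of_length_eq hv.1 hv.2),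
        add_zero]
    · rintro _ ⟨x, hx, rfl⟩
      exact ⟨⟨x, hx.1, rfl⟩, S.mapsTo_F_limitSet w hx.2⟩

/-- Every conformal measure is bounded by a multiple of the Hausdorff measure. -/
theorem IsConformalMeasure.exists_le_hausdorffMeasure [Countable I] {S : CIFS d I} (hd : 0 < d)
    {t : ℝ} (ht : 0 ≤ t) (h0 : μH[t] S.limitSet ≠ 0) (hfin : μH[t] S.limitSet ≠ ∞)
    {m : Measure (EuclideanSpace ℝ (Fin d))} (hm : S.IsConformalMeasure t m) :
    ∃ C : ℝ≥0∞, C ≠ ∞ ∧ ∀ B, MeasurableSet B → m B ≤ C * μH[t] (B ∩ S.limitSet) := by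
  set E := S.limitSet with hE
  have hEm : MeasurableSet E := S.measurableSet_limitSet hd
  have hmp := hm.isProbabilityMeasure
  -- On a cylinder `m` is at most `(K ρ_w)^t` and `ℋ^t` is at least `(ρ_w / K)^t ℋ^t(E)`; `C` is the
  -- quotient.
  set C : ℝ≥0∞ := ENNReal.ofReal ((S.K ^ 2) ^ t) * (μH[t] E)⁻¹ with hC
  have hCfin : C ≠ ∞ := ENNReal.mul_ne_top ENNReal.ofReal_ne_top (ENNReal.inv_ne_top.2 h0)
  have hFE : ∀ w, S.F w '' E ⊆ E := fun w => (S.mapsTo_F_limitSet w).image_subset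
  have hf2 : IsFiniteMeasure (C • (μH[t] : Measure (EuclideanSpace ℝ (Fin d))).restrict E) :=
    ⟨by
      rw [Measure.smul_apply, Measure.restrict_apply_univ, smul_eq_mul]
      exact ENNReal.mul_lt_top hCfin.lt_top hfin.lt_top⟩
  refine ⟨C, hCfin, fun B hB => ?_⟩
  have h := S.measure_le_of_cylinders_le hd m (C • (μH[t] : Measure _).restrict E)
    hm.compl_limitSet hEm Subset.rfl (fun w hw => ?_) (fun w v hwv => ?_) hB
  · rwa [Measure.smul_apply, Measure.restrict_apply hB, smul_eq_mul] at h
  · rw [Measure.smul_apply, Measure.restrict_eq_self _ (hFE w), smul_eq_mul]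
    calc m (S.F w '' E) = _ := hm.conformal w hw E S.limitSet_subset_X hEm
      _ ≤ ENNReal.ofReal ((S.K * S.ratio w) ^ t) * m E :=
          S.lintegral_fderiv_rpow_le ht w m hEm S.limitSet_subset_Ω
      _ ≤ ENNReal.ofReal ((S.K * S.ratio w) ^ t) * 1 := by gcongr; exact prob_le_one
      _ = C * (ENNReal.ofReal ((S.ratio w / S.K) ^ t) * μH[t] E) := by
          rw [S.ofReal_mul_ratio_rpow hd, hC, ← ENNReal.inv_mul_cancel h0 hfin]
          ring
      _ ≤ _ := by
          gcongr
          exact S.le_hausdorffMeasure_F_image hd ht w hEm S.limitSet_subset_Ω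
  · rw [Measure.smul_apply, smul_eq_mul]
    refine mul_eq_zero_of_right _ (measure_mono_null ?_
      (Measure.absolutelyContinuous_of_le Measure.restrict_le_self
        (S.hausdorffMeasure_overlap_eq_zero hd ht hfin hwv)))
    exact inter_subset_inter_right _ (image_mono S.limitSet_subset_X)

end CIFS

/-! ### Upper densities on null sets -/

section Density

open Metric

variable {E : Type*} [NormedAddCommGroup E] [NormedSpace ℝ E] [FiniteDimensional ℝ E]
  [MeasurableSpace E] [BorelSpace E]

/-- Vitali covering inside an open set `U ⊇ A` with `ν U ≤ ε`: disjoint small balls of large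
`ν`-density have total `r^t` at most `ε / η`, and their fivefold enlargements, of diameter at most
`10 r`, cover `A`. -/
theorem hausdorffMeasure_eq_zero_of_frequently_lt_measure_closedBall (ν : Measure E)
    [IsFiniteMeasure ν] {t : ℝ} (ht : 0 < t) {A : Set E} (hA : ν A = 0) {η : ℝ≥0∞}
    (hη0 : η ≠ 0) (hη : η ≠ ∞)
    (h : ∀ a ∈ A, ∃ᶠ r in 𝓝[>] (0 : ℝ), η * ENNReal.ofReal (r ^ t) ≤ ν (closedBall a r)) :
    μH[t] A = 0 := by
  set c : ℝ≥0∞ := ENNReal.ofReal (10 ^ t) * η⁻¹ with hc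
  have hcfin : c ≠ ∞ := ENNReal.mul_ne_top ENNReal.ofReal_ne_top (ENNReal.inv_ne_top.2 hη0)
  suffices hε : ∀ ε : ℝ≥0∞, ε ≠ 0 → μH[t] A ≤ c * ε by
    have hlim : Tendsto (fun ε : ℝ≥0∞ => c * ε) (𝓝[>] 0) (𝓝 (c * 0)) :=
      (ENNReal.Tendsto.const_mul tendsto_id (Or.inr hcfin)).mono_left nhdsWithin_le_nhds
    rw [mul_zero] at hlim
    refine le_antisymm (ge_of_tendsto hlim ?_) (zero_le)
    filter_upwards [self_mem_nhdsWithin] with ε hε'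
    exact hε ε (ne_of_gt hε')
  intro ε hε
  obtain ⟨U, hAU, hU, hUε⟩ := A.exists_isOpen_le_add ν hε
  rw [hA, zero_add] at hUε
  have hfam : ∀ n : ℕ, ∃ u : Set (E × ℝ), u.Countable ∧
      (∀ p ∈ u, 0 < p.2 ∧ p.2 ≤ 1 / ((n : ℝ) + 1) ∧ closedBall p.1 p.2 ⊆ U ∧
        η * ENNReal.ofReal (p.2 ^ t) ≤ ν (closedBall p.1 p.2)) ∧
      u.PairwiseDisjoint (fun p => closedBall p.1 p.2) ∧
      A ⊆ ⋃ p ∈ u, closedBall p.1 (5 * p.2) := by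
    intro n
    have hn : (0 : ℝ) < 1 / ((n : ℝ) + 1) := by positivity
    let T : Set (E × ℝ) := {p | 0 < p.2 ∧ p.2 ≤ 1 / ((n : ℝ) + 1) ∧ closedBall p.1 p.2 ⊆ U ∧
        η * ENNReal.ofReal (p.2 ^ t) ≤ ν (closedBall p.1 p.2)}
    obtain ⟨u, huT, hud, hcov⟩ := Vitali.exists_disjoint_subfamily_covering_enlargement_closedBall
      T (fun p => p.1) (fun p => p.2) (1 / ((n : ℝ) + 1)) (fun p hp => hp.2.1) 5 (by norm_num)
    refine ⟨u, ?_, fun p hp => huT hp, hud, fun a ha => ?_⟩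
    · refine hud.countable_of_nonempty_interior fun p hp => ?_
      exact ⟨p.1, ball_subset_interior_closedBall (mem_ball_self (huT hp).1)⟩
    · obtain ⟨R, hR, hRU⟩ := nhds_basis_closedBall.mem_iff.1 (hU.mem_nhds (hAU ha))
      obtain ⟨r, hr1, hr⟩ := ((h a ha).and_eventually
        (Ioo_mem_nhdsGT (lt_min hn hR))).exists
      obtain ⟨b, hb, hab⟩ := hcov (a, r) ⟨hr.1, hr.2.le.trans (min_le_left _ _),
        (closedBall_subset_closedBall (hr.2.le.trans (min_le_right _ _))).trans hRU, hr1⟩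
      exact mem_iUnion₂.2 ⟨b, hb, hab (mem_closedBall_self hr.1.le)⟩
  choose u huc hu hud hcov using hfam
  have hcnt : ∀ n, Countable (u n) := fun n => (huc n).to_subtype
  have hediam : ∀ n, ∀ p ∈ u n, ediam (closedBall p.1 (5 * p.2)) ≤ ENNReal.ofReal (10 * p.2) := by
    intro n p hp
    refine ediam_le fun x hx y hy => ?_
    rw [edist_dist]
    refine ENNReal.ofReal_le_ofReal ((dist_triangle_right x y p.1).trans ?_)
    rw [mem_closedBall] at hx hy
    linarith
  have hle := Measure.hausdorffMeasure_le_liminf_tsum t A (l := atTop) (ι := fun n => u n)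
    (fun n : ℕ => ENNReal.ofReal (10 * (1 / ((n : ℝ) + 1))))
    (by
      have h1 := (tendsto_one_div_add_atTop_nhds_zero_nat (𝕜 := ℝ)).const_mul 10
      rw [mul_zero] at h1
      simpa [Function.comp_def] using (ENNReal.continuous_ofReal.tendsto 0).comp h1)
    (fun n p => closedBall p.1.1 (5 * p.1.2))
    (Eventually.of_forall fun n p => (hediam n p.1 p.2).trans
      (ENNReal.ofReal_le_ofReal (by gcongr; exact (hu n p.1 p.2).2.1)))
    (Eventually.of_forall fun n a ha => by
      obtain ⟨p, hp, hap⟩ := mem_iUnion₂.1 (hcov n ha)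
      exact mem_iUnion.2 ⟨⟨p, hp⟩, hap⟩)
  refine hle.trans (liminf_le_of_le (by isBoundedDefault) fun b hb => ?_)
  obtain ⟨n, hn⟩ := hb.exists
  refine hn.trans ?_
  calc ∑' p : u n, ediam (closedBall p.1.1 (5 * p.1.2)) ^ t
      ≤ ∑' p : u n, c * ν (closedBall p.1.1 p.1.2) := by
        refine ENNReal.tsum_le_tsum fun p => ?_
        obtain ⟨hp0, -, -, hpν⟩ := hu n p.1 p.2
        calc ediam (closedBall p.1.1 (5 * p.1.2)) ^ t
            ≤ ENNReal.ofReal (10 * p.1.2) ^ t := ENNReal.rpow_le_rpow (hediam n p.1 p.2) ht.le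
          _ = ENNReal.ofReal (10 ^ t) * ENNReal.ofReal (p.1.2 ^ t) := by
              rw [ENNReal.ofReal_rpow_of_nonneg (by positivity) ht.le,
                Real.mul_rpow (by norm_num) hp0.le, ENNReal.ofReal_mul (by positivity)]
          _ = c * (η * ENNReal.ofReal (p.1.2 ^ t)) := by
              rw [hc, mul_assoc, ← mul_assoc η⁻¹, ENNReal.inv_mul_cancel hη0 hη, one_mul]
          _ ≤ _ := by gcongr
    _ = c * ν (⋃ p : u n, closedBall p.1.1 p.1.2) := by
        rw [ENNReal.tsum_mul_left, measure_iUnion]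
        · intro p q hpq
          exact hud n p.2 q.2 fun h => hpq (Subtype.ext h)
        · exact fun p => measurableSet_closedBall
    _ ≤ c * ε := by
        gcongr
        exact (measure_mono (iUnion_subset fun p : u n => (hu n p.1 p.2).2.2.1)).trans hUε

/-- A finite measure has vanishing `t`-density at `ℋ^t`-almost every point of a null set. -/
theorem hausdorffMeasure_not_tendsto_density_zero (ν : Measure E) [IsFiniteMeasure ν] {t : ℝ}
    (ht : 0 < t) {A : Set E} (hA : ν A = 0) :
    μH[t] {a ∈ A | ¬ Tendsto (fun r : ℝ => ν (closedBall a r) / ENNReal.ofReal (r ^ t))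
      (𝓝[>] 0) (𝓝 0)} = 0 := by
  have hsub : {a ∈ A | ¬ Tendsto (fun r : ℝ => ν (closedBall a r) / ENNReal.ofReal (r ^ t))
      (𝓝[>] 0) (𝓝 0)} ⊆ ⋃ n : ℕ, {a ∈ A | ∃ᶠ r in 𝓝[>] (0 : ℝ),
        ((n : ℝ≥0∞) + 1)⁻¹ * ENNReal.ofReal (r ^ t) ≤ ν (closedBall a r)} := by
    rintro a ⟨haA, ha⟩
    rw [ENNReal.tendsto_nhds_zero] at ha
    push Not at ha
    obtain ⟨ε, hε, hfr⟩ := ha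
    obtain ⟨n, hn⟩ := ENNReal.exists_inv_nat_lt hε.ne'
    refine mem_iUnion.2 ⟨n, haA, ?_⟩
    refine (hfr.and_eventually self_mem_nhdsWithin).mono fun r hr => ?_
    have hr0 : 0 < r := hr.2
    have hp : ENNReal.ofReal (r ^ t) ≠ 0 := by simpa using Real.rpow_pos_of_pos hr0 t
    rw [← ENNReal.le_div_iff_mul_le (Or.inl hp) (Or.inl ENNReal.ofReal_ne_top)]
    exact ((ENNReal.inv_le_inv.2 le_self_add).trans hn.le).trans hr.1.le
  refine measure_mono_null hsub (measure_iUnion_null fun n => ?_)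
  exact hausdorffMeasure_eq_zero_of_frequently_lt_measure_closedBall ν ht
    (measure_mono_null (sep_subset _ _) hA) (by simp) (by simp) fun a ha => ha.2

end Density

/-! ### Submanifolds and their tangent cones -/

section Submanifold

open Metric

variable {d l : ℕ}

/-- A submanifold is locally closed: in each chart domain it is the zero set of continuous
functions, so it is the intersection of an open set with its closure. -/
theorem IsC1Submanifold.measurableSet {M : Set (EuclideanSpace ℝ (Fin d))}
    (hM : IsC1Submanifold l M) : MeasurableSet M := by
  choose e hpe he he' heM using hM
  set U : Set (EuclideanSpace ℝ (Fin d)) := ⋃ (p) (hp : p ∈ M), (e p hp).source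
  have hU : IsOpen U := isOpen_iUnion fun p => isOpen_iUnion fun hp => (e p hp).open_source
  have : M = U ∩ closure M := by
    refine Subset.antisymm (fun p hp => ⟨mem_iUnion₂.2 ⟨p, hp, hpe p hp⟩, subset_closure hp⟩) ?_
    rintro x ⟨hxU, hxc⟩
    obtain ⟨p, hp, hxp⟩ := mem_iUnion₂.1 hxU
    rw [heM p hp x hxp]
    intro j hj
    by_contra hne
    have hcont : ContinuousOn (fun z => e p hp z j) (e p hp).source :=
      (EuclideanSpace.proj j : EuclideanSpace ℝ (Fin d) →L[ℝ] ℝ).continuous.comp_continuousOn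
        (e p hp).continuousOn
    have hZ : IsOpen ((e p hp).source ∩ (fun z => e p hp z j) ⁻¹' {0}ᶜ) :=
      hcont.isOpen_inter_preimage (e p hp).open_source isOpen_compl_singleton
    obtain ⟨z, ⟨hz, hz0⟩, hzM⟩ := mem_closure_iff.1 hxc _ hZ ⟨hxp, hne⟩
    exact hz0 ((heM p hp z hz).1 hzM j hj)
  rw [this]
  exact hU.measurableSet.inter isClosed_closure.measurableSet

/-- The inclusion of `ℝ^l` into `ℝ^d` as the span of the first `l` coordinate vectors. -/
noncomputable def coordinateInclusion (d l : ℕ) : (Fin l → ℝ) →ₗ[ℝ] EuclideanSpace ℝ (Fin d) where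
  toFun c := WithLp.toLp 2 fun j => if h : (j : ℕ) < l then c ⟨j, h⟩ else 0
  map_add' c c' := by
    ext j
    by_cases h : (j : ℕ) < l <;> simp [h]
  map_smul' a c := by
    ext j
    by_cases h : (j : ℕ) < l <;> simp [h]

theorem coordinateInclusion_apply (c : Fin l → ℝ) (j : Fin d) :
    coordinateInclusion d l c j = if h : (j : ℕ) < l then c ⟨j, h⟩ else 0 := rfl

theorem coordinateInclusion_injective (hld : l ≤ d) :
    Function.Injective (coordinateInclusion d l) := by
  intro c c' h
  ext i
  have := congrArg (fun v : EuclideanSpace ℝ (Fin d) => v (Fin.castLE hld i)) h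
  simpa [coordinateInclusion_apply] using this

theorem mem_range_coordinateInclusion (hld : l ≤ d) {v : EuclideanSpace ℝ (Fin d)}
    (hv : ∀ j : Fin d, l ≤ (j : ℕ) → v j = 0) : v ∈ LinearMap.range (coordinateInclusion d l) := by
  refine ⟨fun i => v (Fin.castLE hld i), ?_⟩
  ext j
  rw [coordinateInclusion_apply]
  split_ifs with h
  · rfl
  · exact (hv j (not_lt.1 h)).symm

/-- A `C¹`-submanifold is contained in small cones around its tangent space, locally. -/
theorem IsC1Submanifold.exists_tangent (hld : l ≤ d) {M : Set (EuclideanSpace ℝ (Fin d))}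
    (hM : IsC1Submanifold l M) {a : EuclideanSpace ℝ (Fin d)} (ha : a ∈ M) :
    ∃ V : Submodule ℝ (EuclideanSpace ℝ (Fin d)), Module.finrank ℝ V = l ∧
      ∀ δ : ℝ, 0 < δ → ∀ᶠ x in 𝓝 a, x ∈ M → x ≠ a → x ∈ coneAround a V δ := by
  obtain ⟨e, hae, he, he', heM⟩ := hM a ha
  have hd : DifferentiableAt ℝ e a :=
    (he.differentiableOn one_ne_zero).differentiableAt (e.open_source.mem_nhds hae)
  have hd' : DifferentiableAt ℝ e.symm (e a) :=
    (he'.differentiableOn one_ne_zero).differentiableAt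
      (e.open_target.mem_nhds (e.map_source hae))
  set L := fderiv ℝ e.symm (e a) with hL
  have hLinj : Function.Injective L := by
    have h1 : HasFDerivAt (e ∘ e.symm) ((fderiv ℝ e a).comp L) (e a) := by
      refine HasFDerivAt.comp (e a) ?_ hd'.hasFDerivAt
      rw [e.left_inv hae]
      exact hd.hasFDerivAt
    have h2 : HasFDerivAt (e ∘ e.symm) (ContinuousLinearMap.id ℝ _) (e a) := by
      refine (hasFDerivAt_id (e a)).congr_of_eventuallyEq ?_
      filter_upwards [e.open_target.mem_nhds (e.map_source hae)] with y hy
      exact e.right_inv hy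
    have h3 := h1.unique h2
    intro x y hxy
    have hx := congrArg (fun T : EuclideanSpace ℝ (Fin d) →L[ℝ] EuclideanSpace ℝ (Fin d) => T x) h3
    have hy := congrArg (fun T : EuclideanSpace ℝ (Fin d) →L[ℝ] EuclideanSpace ℝ (Fin d) => T y) h3
    simp only [ContinuousLinearMap.comp_apply, ContinuousLinearMap.id_apply] at hx hy
    rw [← hx, ← hy, hxy]
  -- The tangent space is the image of `ℝ^l × {0}` under the derivative of the inverse chart.
  set V := LinearMap.range (L.toLinearMap ∘ₗ coordinateInclusion d l) with hV
  refine ⟨V, ?_, fun δ hδ => ?_⟩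
  · rw [hV, LinearMap.finrank_range_of_inj (f := L.toLinearMap ∘ₗ coordinateInclusion d l)
      (Function.Injective.comp (g := L) hLinj (coordinateInclusion_injective hld)),
      Module.finrank_fin_fun]
  obtain ⟨C, hC0, hC⟩ := hd.isBigO_sub.exists_pos
  have hsq : 0 < √δ := Real.sqrt_pos.2 hδ
  -- `C` bounds the growth of the chart at `a`; the extra factor `2` makes the final cone inequality
  -- strict.
  have hlit := (hd'.hasFDerivAt.isLittleO.def (show 0 < √δ / (2 * C) by positivity))
  have hlit' := hd.continuousAt.eventually hlit
  filter_upwards [hlit', hC.bound, e.open_source.mem_nhds hae] with x hx1 hx2 hxs hxM hxa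
  rw [e.left_inv hae, e.left_inv hxs] at hx1
  have hmem : L (e x - e a) ∈ V := by
    obtain ⟨c, hc⟩ := mem_range_coordinateInclusion hld (v := e x - e a) (fun j hj => by
      rw [PiLp.sub_apply, (heM x hxs).1 hxM j hj, (heM a hae).1 ha j hj, sub_zero])
    exact ⟨c, congrArg L hc⟩
  have hQ : Vᗮ.starProjection (x - a) = Vᗮ.starProjection (x - a - L (e x - e a)) := by
    rw [map_sub _ (x - a), Submodule.starProjection_orthogonal_apply_eq_zero hmem, sub_zero]
  have hxpos : 0 < ‖x - a‖ := norm_pos_iff.2 (sub_ne_zero.2 hxa)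
  change ‖Vᗮ.starProjection (x - a)‖ < √δ * ‖x - a‖
  rw [hQ]
  calc ‖Vᗮ.starProjection (x - a - L (e x - e a))‖ ≤ ‖x - a - L (e x - e a)‖ :=
        Submodule.norm_starProjection_apply_le _ _
    _ ≤ √δ / (2 * C) * ‖e x - e a‖ := hx1
    _ ≤ √δ / (2 * C) * (C * ‖x - a‖) := by gcongr
    _ = √δ * ‖x - a‖ / 2 := by field_simp
    _ < √δ * ‖x - a‖ := half_lt_self (by positivity)

theorem isOpen_coneAround (a : EuclideanSpace ℝ (Fin d))
    (V : Submodule ℝ (EuclideanSpace ℝ (Fin d))) (δ : ℝ) : IsOpen (coneAround a V δ) :=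
  isOpen_lt (by fun_prop) (by fun_prop)

end Submanifold

/-! ### The dichotomy -/

theorem mainTheorem3 {d l : ℕ} (hl : 0 < l) (hld : l < d) {I : Type*} [Countable I] [Nontrivial I]
    (S : CIFS d I) (t : ℝ≥0) (ht : dimH S.limitSet = (t : ℝ≥0∞)) :
    (∀ M : Set (EuclideanSpace ℝ (Fin d)), IsC1Submanifold l M →
      μH[(t : ℝ)] (S.limitSet ∩ M) = 0) ∨
    (S.IsRegular t ∧
      ∀ m : Measure (EuclideanSpace ℝ (Fin d)), S.IsConformalMeasure t m →
        ∃ a ∈ S.limitSet, ∃ V : Submodule ℝ (EuclideanSpace ℝ (Fin d)),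
          IsTangentPlane m t l a V) := by
  have hd : 0 < d := hl.trans hld
  rw [or_iff_not_imp_left]
  intro hno
  push Not at hno
  obtain ⟨M, hM, hM0⟩ := hno
  set E := S.limitSet with hE
  have hEm : MeasurableSet E := S.measurableSet_limitSet hd
  have hMm : MeasurableSet M := hM.measurableSet
  have ht0 : (0 : ℝ) < t := S.dimH_pos hd ht
  have hfin : μH[(t : ℝ)] E ≠ ∞ := (S.hausdorffMeasure_limitSet_lt_top hd ht).ne
  have hE0 : μH[(t : ℝ)] E ≠ 0 := fun h => hM0 (measure_mono_null inter_subset_left h)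
  refine ⟨⟨_, S.isConformalMeasure_hausdorffMeasure hd ht0.le hE0 hfin⟩, fun m hm => ?_⟩
  obtain ⟨C, hC, hmC⟩ := hm.exists_le_hausdorffMeasure hd ht0.le hE0 hfin
  -- This measure does not charge `E ∩ M`, so its `t`-density vanishes at almost every point there;
  -- positivity of `ℋ^t(E ∩ M)` supplies such a point.
  set ν := (μH[(t : ℝ)] : Measure (EuclideanSpace ℝ (Fin d))).restrict (E \ M) with hν
  have hνfin : IsFiniteMeasure ν := ⟨by
    rw [hν, Measure.restrict_apply_univ]
    exact (measure_mono sdiff_subset).trans_lt hfin.lt_top⟩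
  have hν0 : ν (E ∩ M) = 0 := by
    rw [hν, Measure.restrict_apply (hEm.inter hMm)]
    convert measure_empty (μ := (μH[(t : ℝ)] : Measure (EuclideanSpace ℝ (Fin d))))
    ext x
    simp only [mem_inter_iff, Set.mem_sdiff, mem_empty_iff_false]
    tauto
  obtain ⟨a, ⟨haE, haM⟩, hdens⟩ : ∃ a ∈ E ∩ M,
      Tendsto (fun r : ℝ => ν (Metric.closedBall a r) / ENNReal.ofReal (r ^ (t : ℝ)))
        (𝓝[>] 0) (𝓝 0) := by
    by_contra! hcon
    refine hM0 (measure_mono_null (fun x hx => ?_)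
      (hausdorffMeasure_not_tendsto_density_zero ν ht0 hν0))
    exact ⟨hx, hcon x hx⟩
  obtain ⟨V, hVl, hV⟩ := hM.exists_tangent hld.le haM
  refine ⟨a, haE, V, hVl, fun δ hδ _ => ?_⟩
  obtain ⟨R, hR, hRc⟩ := Metric.nhds_basis_closedBall.eventually_iff.1 (hV δ hδ)
  -- The vertex `a` belongs to `M` but not to the strict cone; it is harmless because points are
  -- null for `t > 0`.
  have := Measure.nullSingletonClass_hausdorff (EuclideanSpace ℝ (Fin d)) ht0
  have hlim : Tendsto (fun r : ℝ => C * (ν (Metric.closedBall a r) /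
      ENNReal.ofReal (r ^ (t : ℝ)))) (𝓝[>] 0) (𝓝 0) := by
    simpa using ENNReal.Tendsto.const_mul hdens (Or.inr hC)
  refine tendsto_of_tendsto_of_tendsto_of_le_of_le' tendsto_const_nhds hlim
    (Eventually.of_forall fun _ => zero_le) ?_
  filter_upwards [Ioo_mem_nhdsGT hR] with r hr
  rw [← mul_div_assoc]
  gcongr
  refine (hmC _ (measurableSet_closedBall.diff (isOpen_coneAround a V δ).measurableSet)).trans ?_
  refine mul_le_mul_right ?_ C
  rw [hν, Measure.restrict_apply measurableSet_closedBall]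
  calc μH[(t : ℝ)] ((Metric.closedBall a r \ coneAround a V δ) ∩ E)
      ≤ μH[(t : ℝ)] ((Metric.closedBall a r ∩ (E \ M)) ∪ {a}) := by
        refine measure_mono ?_
        rintro x ⟨⟨hxr, hxc⟩, hxE⟩
        by_cases hxa : x = a
        · exact Or.inr hxa
        · refine Or.inl ⟨hxr, hxE, fun hxM => hxc ?_⟩
          exact hRc (Metric.closedBall_subset_closedBall hr.2.le hxr) hxM hxa
    _ ≤ μH[(t : ℝ)] (Metric.closedBall a r ∩ (E \ M)) + μH[(t : ℝ)] {a} := measure_union_le _ _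
    _ = μH[(t : ℝ)] (Metric.closedBall a r ∩ (E \ M)) := by rw [measure_singleton, add_zero]
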